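/- Let $k\ge 1$ be an integer, $m=4k+4$ and $\theta=2\pi/m$. Around every point $u$ of the plane consider $m$ rays with angle $\theta$ between consecutive rays; they bound cones $C_0^u,\dots,C_{m-1}^u$, numbered clockwise, where $C_0^u$ is bisected by the upward vertical halfline from $u$. Let $P$ be a finite set of points in the plane in general position: no two points of $P$ lie on a line parallel to one of the rays bounding the cones, no two lie on a line perpendicular to the bisector of a cone, and no three are collinear. Let $S$ be a set of segments (constraints) between distinct points of $P$, no two of which intersect properly. Two points $u,v\in P$ can see each other if the segment $uv$ is a constraint or does not properly intersect any constraint. For $u\in P$, the lines through the constraints $uv\in S$ with $v\in C_i^u$ split $C_i^u$ into subcones; such a $v$ belongs to both subcones it separates, and a cone that is not split is its own only subcone. The constrained $\theta$-graph with $m$ cones has vertex set $P$ and, for every subcone of every cone $C_i^u$ of every $u\in P$, an undirected edge from $u$ to the vertex of $P\setminus\{u\}$ in that subcone that can see $u$ and whose projection on the bisector of $C_i^u$ is closest to $u$ (if there is such a vertex). Theorem. Let $u\neq w$ be points of $P$ that can see each other. Let $C_i^u$ be the cone of $u$ that contains $w$, let $T_{uw}$ be the triangle bounded by the two borders of $C_i^u$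 and the line through $w$ perpendicular to the bisector of $C_i^u$, let $M$ be the midpoint of the side of $T_{uw}$ opposite $u$, and let $\alpha=\angle wuM$ be the unsigned angle between $uw$ and $uM$. Then the constrained $\theta$-graph with $4k+4$ cones contains a path between $u$ and $w$ of Euclidean length at most $$\left(\frac{\cos\alpha}{\cos\left(\frac{\theta}{2}\right)}+\frac{\cos\alpha\cdot\tan\left(\frac{\theta}{2}\right)+\sin\alpha}{\cos\left(\frac{\theta}{2}\right)-\sin\left(\frac{\theta}{2}\right)}\right)\cdot|uw|.$$ -/

import Mathlib

noncomputable section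

namespace ConstrainedTheta

/-- The Euclidean plane; coordinate `0` is horizontal and coordinate `1` is vertical. -/
abbrev Plane : Type := EuclideanSpace ℝ (Fin 2)

/-- The aperture `θ = 2π/m` of the cones when there are `m` of them around each vertex. -/
def aperture (m : ℕ) : ℝ := 2 * Real.pi / m

/-- The unit vector at clockwise angle `φ` from the upward vertical direction. -/
def dir (φ : ℝ) : Plane := !₂[Real.sin φ, Real.cos φ]

/-- The direction of the bisector of the `i`-th cone. Cones are numbered clockwise, cone `0` is
bisected by the upward vertical halfline, and the index is read modulo `m`. -/
def bisector (m : ℕ) (i : ℤ) : Plane := dir (i * aperture m)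

/-- The direction of the ray that bounds the `i`-th cone on its counterclockwise side; its other
bounding ray is `ray m (i + 1)`. -/
def ray (m : ℕ) (i : ℤ) : Plane := dir ((i - 1 / 2) * aperture m)

/-- The cone `C_i^u`: the (closed) region between the `i`-th and the next ray from `u`. -/
def cone (m : ℕ) (i : ℤ) (u : Plane) : Set Plane :=
  {p | ∃ s t : ℝ, 0 ≤ s ∧ 0 ≤ t ∧ p = u + s • ray m i + t • ray m (i + 1)}

/-- General position with respect to `m` cones: no two points on a line parallel to a bounding ray
of a cone, no two points on a line perpendicular to the bisector of a cone, no three collinear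
points. -/
structure GeneralPosition (m : ℕ) (P : Finset Plane) : Prop where
  not_parallel : ∀ p ∈ P, ∀ q ∈ P, p ≠ q → ∀ (i : ℤ) (t : ℝ), q - p ≠ t • ray m i
  not_perpendicular : ∀ p ∈ P, ∀ q ∈ P, p ≠ q → ∀ i : ℤ, inner ℝ (q - p) (bisector m i) ≠ 0
  not_collinear : ∀ p ∈ P, ∀ q ∈ P, ∀ r ∈ P, p ≠ q → p ≠ r → q ≠ r → ¬ Collinear ℝ {p, q, r}

/-- Two nondegenerate segments `ab` and `cd` intersect properly: they cross in a single point that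
is interior to both. -/
def ProperlyIntersect (a b c d : Plane) : Prop :=
  ∃ x, openSegment ℝ a b ∩ openSegment ℝ c d = {x}

/-- A set of constraints (segments between distinct points of `P`, given as the graph of their
endpoint pairs) is planar if no two constraints intersect properly. -/
def PlanarConstraints {P : Finset Plane} (S : SimpleGraph P) : Prop :=
  ∀ a b c d : P, S.Adj a b → S.Adj c d → ¬ ProperlyIntersect a b c d

/-- `u` and `v` can see each other: the segment `uv` is a constraint or it does not properly
intersect any constraint. -/
def CanSee {P : Finset Plane} (S : SimpleGraph P) (u v : P) : Prop :=
  S.Adj u v ∨ ∀ c d : P, S.Adj c d → ¬ ProperlyIntersect u v c d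

/-- The signed area of the parallelogram spanned by `p` and `q`; its sign tells on which side of
the line spanned by `p` the vector `q` lies. -/
def cross (p q : Plane) : ℝ := p 0 * q 1 - p 1 * q 0

/-- `C` is a subcone of the cone `C_i^u`. The lines through the constraints that have `u` as an
endpoint and whose other endpoint lies in `C_i^u` split `C_i^u`; the piece that contains a point `d`
of `C_i^u` off all these lines consists of the points that lie, for each of the lines, on the same
closed side as `d`. (In particular the far endpoint of such a constraint lies in both of the
subcones that it bounds, and an unsplit cone is its own only subcone.) -/
def IsSubcone (m : ℕ) {P : Finset Plane} (S : SimpleGraph P) (i : ℤ) (u : P) (C : Set Plane) :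
    Prop :=
  ∃ d ∈ cone m i u,
    (∀ v : P, S.Adj u v → (v : Plane) ∈ cone m i u →
      cross ((v : Plane) - u) (d - u) ≠ 0) ∧
    C = {p | p ∈ cone m i u ∧ ∀ v : P, S.Adj u v → (v : Plane) ∈ cone m i u →
      0 ≤ cross ((v : Plane) - u) (d - u) * cross ((v : Plane) - u) (p - u)}

/-- `v` is, for some subcone of a cone `C_i^u`, a closest vertex to `u` among the vertices in that
subcone that can see `u`, where distance from `u` is measured along the bisector of `C_i^u`. -/
def IsClosestInSubcone (m : ℕ) {P : Finset Plane} (S : SimpleGraph P) (u v : P) : Prop :=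
  v ≠ u ∧ CanSee S u v ∧ ∃ (i : ℤ) (C : Set Plane), IsSubcone m S i u C ∧ (v : Plane) ∈ C ∧
    ∀ w : P, w ≠ u → CanSee S u w → (w : Plane) ∈ C →
      inner ℝ ((v : Plane) - u) (bisector m i) ≤ inner ℝ ((w : Plane) - u) (bisector m i)

/-- The constrained `θ`-graph with `m` cones: for each subcone of each vertex `u`, an (undirected)
edge from `u` to the closest vertex in that subcone that can see `u`. -/
def constrainedThetaGraph (m : ℕ) {P : Finset Plane} (S : SimpleGraph P) : SimpleGraph P :=
  SimpleGraph.fromRel (IsClosestInSubcone m S)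

/-- The Euclidean length of a walk. -/
def walkLength {P : Finset Plane} {G : SimpleGraph P} {u w : P} (p : G.Walk u w) : ℝ :=
  (p.darts.map fun e => dist (e.fst : Plane) (e.snd : Plane)).sum

/-- The corner, on the `j`-th ray from `u`, of the canonical triangle of `u` and `w` in the cone
`C_i^u` (where `j = i` or `j = i + 1`): the point of that ray which has the same projection as `w`
on the bisector of `C_i^u`. -/
def canonicalCorner (m : ℕ) (i j : ℤ) (u w : Plane) : Plane :=
  u + (inner ℝ (w - u) (bisector m i) / inner ℝ (ray m j) (bisector m i)) • ray m j

/-- The midpoint of the side opposite to `u` of the canonical triangle of `u` and `w`, which is the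
triangle bounded by the two borders of `C_i^u` and the line through `w` perpendicular to the
bisector of `C_i^u`. -/
def oppositeMidpoint (m : ℕ) (i : ℤ) (u w : Plane) : Plane :=
  midpoint ℝ (canonicalCorner m i i u w) (canonicalCorner m i (i + 1) u w)

end ConstrainedTheta

end

namespace ConstrainedTheta

/-! Let `X`, `Y` be the coordinates of `w - u` across and along the bisector of its cone, and c = 1
/ (cos (θ/2) - sin (θ/2)). Since |X| = |uw| sin α and Y = |uw| cos α, the claimed bound simplifies
to c (|X| + |Y|). It is therefore enough to bound walks by c times the ℓ¹-distance in the frame of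
the cone (`walkWithin_of_canSee`), by induction on the rank of that distance among all pairs of
vertices.

Let v be the closest visible vertex in a subcone of u containing w. The edge uv makes an angle of at
most θ/2 < π/4 with the bisector, so it costs at most c (Y(v) - |X(v)|) (`norm_mul_le_of_mem_cone`):
horizontal displacement is a gain. From v to w, a chain of mutually visible vertices inside the
triangle uvw is followed, and each link is handled by induction. The chain rises throughout, going
first right and then left (`walkWithin_triangle`), so its ℓ¹-length telescopes. What the edge uv
saves horizontally pays for the chain's start at v, and the sum is c (|X(w)| + Y(w)).

Two facts make this work. If v and w do not see each other, the vertex of the triangle farthest from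
vw is seen by u and splits the triangle (`exists_canSee_mem_triangle`). A link may lie in a
different cone from uw, but since the number of cones is divisible by 4, its ℓ¹-norm in its own
frame is at most that in the frame of uw (`frame_l1_le`). -/

/-! ### Segments and constraints in general position -/

theorem not_smul_of_generalPosition {m : ℕ} {P : Finset Plane} (hP : GeneralPosition m P)
    {p q r : Plane} (hp : p ∈ P) (hq : q ∈ P) (hr : r ∈ P) (hpq : p ≠ q) (hpr : p ≠ r)
    (hqr : q ≠ r) (t : ℝ) : r - p ≠ t • (q - p) := by
  intro h
  refine hP.not_collinear p hp q hq r hr hpq hpr hqr ?_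
  rw [collinear_iff_of_mem (p₀ := p) (by simp)]
  refine ⟨q - p, ?_⟩
  intro x hx
  simp only [Set.mem_insert_iff, Set.mem_singleton_iff] at hx
  rcases hx with rfl | rfl | rfl
  · exact ⟨0, by simp⟩
  · exact ⟨1, by simp⟩
  · exact ⟨t, by rw [← h]; simp⟩

/-- A point of `P` on the line through two points of `P` is one of them. -/
theorem eq_or_eq_of_mem_line {m : ℕ} {P : Finset Plane} (hP : GeneralPosition m P)
    {p q r : P} (hpq : p ≠ q) (t : ℝ) (h : (r : Plane) - p = t • ((q : Plane) - p)) :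
    r = p ∨ r = q := by
  by_contra hc
  push Not at hc
  exact not_smul_of_generalPosition hP p.2 q.2 r.2 (fun e => hpq (Subtype.ext e))
    (fun e => hc.1 (Subtype.ext e.symm)) (fun e => hc.2 (Subtype.ext e.symm)) t h

theorem mem_openSegment_iff_smul {a b x : Plane} :
    x ∈ openSegment ℝ a b ↔ ∃ t : ℝ, 0 < t ∧ t < 1 ∧ x = a + t • (b - a) := by
  constructor
  · rintro ⟨s, t, hs, ht, hst, rfl⟩
    refine ⟨t, ht, by linarith, ?_⟩
    obtain rfl : s = 1 - t := by linarith
    module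
  · rintro ⟨t, h0, h1, rfl⟩
    exact ⟨1 - t, t, by linarith, h0, by ring, by module⟩

/-- A visibility segment meets the interior of no constraint other than itself. -/
theorem eq_of_canSee_of_mem_openSegment {m : ℕ} {P : Finset Plane} {S : SimpleGraph P}
    (hP : GeneralPosition m P) (hS : PlanarConstraints S) {u v c d : P} (huv : u ≠ v)
    (hsee : CanSee S u v) (hcd : S.Adj c d) {x : Plane}
    (hx : x ∈ openSegment ℝ (u : Plane) v) (hx' : x ∈ openSegment ℝ (c : Plane) d) :
    (c = u ∧ d = v) ∨ (c = v ∧ d = u) := by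
  have hnp : ¬ ProperlyIntersect u v c d := by
    rcases hsee with h | h
    · exact hS _ _ _ _ h hcd
    · exact h _ _ hcd
  have hcd' : c ≠ d := hcd.ne
  -- A proper intersection is a single common point of the open segments. Without one, a common
  -- point comes with a second, so the segments lie on one line, and general position identifies
  -- their endpoints.
  have : ∃ y, y ≠ x ∧ y ∈ openSegment ℝ (u : Plane) v ∧ y ∈ openSegment ℝ (c : Plane) d := by
    by_contra hc
    push Not at hc
    refine hnp ⟨x, Set.eq_singleton_iff_unique_mem.2 ⟨⟨hx, hx'⟩, ?_⟩⟩
    rintro y ⟨hy, hy'⟩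
    by_contra hyx
    exact hc y hyx hy hy'
  obtain ⟨y, hyx, hy, hy'⟩ := this
  obtain ⟨s, -, -, hs⟩ := mem_openSegment_iff_smul.1 hx
  obtain ⟨s', -, -, hs'⟩ := mem_openSegment_iff_smul.1 hy
  obtain ⟨t, -, -, ht⟩ := mem_openSegment_iff_smul.1 hx'
  obtain ⟨t', -, -, ht'⟩ := mem_openSegment_iff_smul.1 hy'
  have htt : t' - t ≠ 0 := by
    intro h
    apply hyx
    rw [ht, ht', sub_eq_zero.1 h]
  have hdir : (d : Plane) - c = ((s' - s) / (t' - t)) • ((v : Plane) - u) := by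
    have : (t' - t) • ((d : Plane) - c) = (s' - s) • ((v : Plane) - u) := by
      have e1 : (t' - t) • ((d : Plane) - c) = y - x := by rw [ht, ht']; module
      have e2 : (s' - s) • ((v : Plane) - u) = y - x := by rw [hs, hs']; module
      rw [e1, e2]
    rw [div_eq_inv_mul, mul_smul, ← this, smul_smul, inv_mul_cancel₀ htt, one_smul]
  set r := (s' - s) / (t' - t)
  have hc : (c : Plane) - u = (s - t * r) • ((v : Plane) - u) := by
    have : (c : Plane) = x - t • ((d : Plane) - c) := by rw [ht]; module
    rw [this, hdir, hs]; module
  have hd : (d : Plane) - u = (s - t * r + r) • ((v : Plane) - u) := by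
    have : (d : Plane) - u = (c - u) + (d - c) := by abel
    rw [this, hdir, hc]; module
  rcases eq_or_eq_of_mem_line hP huv _ hc with h1 | h1 <;>
    rcases eq_or_eq_of_mem_line hP huv _ hd with h2 | h2
  · exact absurd (h1.trans h2.symm) hcd'
  · exact Or.inl ⟨h1, h2⟩
  · exact Or.inr ⟨h1, h2⟩
  · exact absurd (h1.trans h2.symm) hcd'

/-! ### Constraints that meet a triangle with two visible sides -/

/-- `p` has coordinates `a, b` in the affine frame with origin `u` and unit points `v`, `w`. -/
def HasCoords (u v w p : Plane) (a b : ℝ) : Prop := p = u + a • (v - u) + b • (w - u)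

/-- No constraint at `u` leaves strictly between the directions of `v` and `w`. -/
def FreeSector {P : Finset Plane} (S : SimpleGraph P) (u v w : P) : Prop :=
  ∀ c : P, S.Adj u c → ∀ a b : ℝ, 0 < a → 0 < b → ¬ HasCoords u v w c a b

theorem HasCoords.swap {u v w p : Plane} {a b : ℝ} (h : HasCoords u v w p a b) :
    HasCoords u w v p b a := by
  unfold HasCoords at *; rw [h]; module

theorem FreeSector.swap {P : Finset Plane} {S : SimpleGraph P} {u v w : P}
    (h : FreeSector S u v w) : FreeSector S u w v :=
  fun c hc a b ha hb hco => h c hc b a hb ha hco.swap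

/-- A constraint through an interior point of the triangle `uvw` does not leave it through the
side `uw`. -/
theorem not_exit_side {m : ℕ} {P : Finset Plane} {S : SimpleGraph P}
    (hP : GeneralPosition m P) (hS : PlanarConstraints S) {u v w c d : P}
    (huw : u ≠ w) (hw : CanSee S u w) (hfree : FreeSector S u v w)
    (huniq : ∀ a b : ℝ, a • ((v : Plane) - u) + b • ((w : Plane) - u) = 0 → a = 0 ∧ b = 0)
    (hcd : S.Adj c d) {q : Plane} (hq : q ∈ openSegment ℝ (c : Plane) d)
    {a₀ b₀ a₁ b₁ : ℝ} (hqc : HasCoords u v w q a₀ b₀) (ha₀ : 0 < a₀) (hb₀ : 0 < b₀)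
    (hle : a₀ + b₀ ≤ 1) (hc : HasCoords u v w c a₁ b₁) (hlt : a₁ + b₁ < 1) (ha₁ : a₁ ≤ 0)
    (hdet : 0 ≤ a₀ * b₁ - a₁ * b₀) : False := by
  unfold HasCoords at hqc hc
  obtain ⟨t, ht0, ht1, ht⟩ := mem_openSegment_iff_smul.1 hq
  -- A constraint from u through q would run strictly inside the free sector.
  have hcu : c ≠ u := by
    rintro rfl
    refine hfree d hcd (a₀ / t) (b₀ / t) (by positivity) (by positivity) ?_
    unfold HasCoords
    have e : t • ((d : Plane) - c) = a₀ • ((v : Plane) - c) + b₀ • ((w : Plane) - c) := by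
      have : t • ((d : Plane) - c) = q - c := by rw [ht]; module
      rw [this, hqc]; module
    have e2 : (d : Plane) - c = t⁻¹ • (t • ((d : Plane) - c)) := by
      rw [smul_smul, inv_mul_cancel₀ ht0.ne', one_smul]
    have e3 : (d : Plane) = c + ((d : Plane) - c) := by abel
    rw [e3, e2, e]; module
  have hpos : 0 < a₀ - a₁ := by linarith
  -- The segment from q to c meets the line uw at parameter r, at distance ratio β from u. The
  -- determinant condition gives β ≥ 0; the bounds on the coordinate sums give β < 1.
  set r := a₀ / (a₀ - a₁) with hr
  have hr0 : 0 < r := div_pos ha₀ hpos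
  have hr1 : r ≤ 1 := by rw [hr, div_le_one hpos]; linarith
  have hra : (1 - r) * a₀ + r * a₁ = 0 := by rw [hr]; field_simp; ring
  set β := (1 - r) * b₀ + r * b₁ with hβ
  have hβ0 : 0 ≤ β := by
    have : β = (a₀ * b₁ - a₁ * b₀) / (a₀ - a₁) := by rw [hβ, hr]; field_simp; ring
    rw [this]; positivity
  have hβ1 : β < 1 := by nlinarith
  have hx : q + r • ((c : Plane) - q) = u + β • ((w : Plane) - u) := by
    have : q + r • ((c : Plane) - q) =
        u + ((1 - r) * a₀ + r * a₁) • ((v : Plane) - u) + β • ((w : Plane) - u) := by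
      rw [hqc, hc, hβ]; module
    rw [this, hra]; simp
  -- For r < 1 the crossing is interior to cd. If β > 0, visibility of w forces cd to be uw, which
  -- misses q; if β = 0, the vertex u is interior to cd. For r = 1 the vertex c is on the line uw,
  -- hence u or w, and both are excluded.
  rcases hr1.lt_or_eq with hr1 | hr1
  · have hxcd : q + r • ((c : Plane) - q) ∈ openSegment ℝ (c : Plane) d := by
      rw [mem_openSegment_iff_smul]
      refine ⟨t * (1 - r), mul_pos ht0 (by linarith), by nlinarith, ?_⟩
      rw [ht]; module
    rcases hβ0.lt_or_eq with hβ0 | hβ0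
    · have hxuw : q + r • ((c : Plane) - q) ∈ openSegment ℝ (u : Plane) w := by
        rw [mem_openSegment_iff_smul]
        exact ⟨β, hβ0, hβ1, hx⟩
      have hqw : ∃ s : ℝ, q = u + s • ((w : Plane) - u) := by
        rcases eq_of_canSee_of_mem_openSegment hP hS huw hw hcd hxuw hxcd with ⟨h1, h2⟩ | ⟨h1, h2⟩
        · exact absurd h1 hcu
        · exact ⟨1 - t, by rw [ht, h1, h2]; module⟩
      obtain ⟨s, hs⟩ := hqw
      have := (huniq a₀ (b₀ - s) (by
        have : a₀ • ((v : Plane) - u) + (b₀ - s) • ((w : Plane) - u) =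
          (u + a₀ • ((v : Plane) - u) + b₀ • ((w : Plane) - u)) - (u + s • ((w : Plane) - u)) := by
          module
        rw [this, ← hqc, ← hs, sub_self])).1
      linarith
    · rw [← hβ0, zero_smul, add_zero] at hx
      rw [hx] at hxcd
      obtain ⟨s, hs0, hs1, hs⟩ := mem_openSegment_iff_smul.1 hxcd
      rcases eq_or_eq_of_mem_line hP hcd.ne s (r := u) (by rw [hs]; module) with h | h
      · exact hcu h.symm
      · rw [h] at hs
        have h0 : (1 - s) • ((d : Plane) - c) = 0 := by
          have : (1 - s) • ((d : Plane) - c) = d - (c + s • ((d : Plane) - c)) := by module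
          rw [this, ← hs, sub_self]
        rcases smul_eq_zero.1 h0 with h0 | h0
        · linarith
        · exact hcd.ne (Subtype.ext (sub_eq_zero.1 h0).symm)
  · rw [hr1, one_smul, add_sub_cancel] at hx
    rcases eq_or_eq_of_mem_line hP huw β (r := c) (by rw [hx]; module) with h | h
    · exact hcu h
    · rw [h] at hx
      have h0 : (1 - β) • ((w : Plane) - u) = 0 := by
        have : (1 - β) • ((w : Plane) - u) = w - (u + β • ((w : Plane) - u)) := by module
        rw [this, ← hx, sub_self]
      rcases smul_eq_zero.1 h0 with h0 | h0
      · linarith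
      · exact huw (Subtype.ext (sub_eq_zero.1 h0).symm)

/-- A constraint through an interior point of the triangle `uvw` that does not leave it through
the side `vw` has an endpoint inside the triangle. -/
theorem endpoint_mem_triangle {m : ℕ} {P : Finset Plane} {S : SimpleGraph P}
    (hP : GeneralPosition m P) (hS : PlanarConstraints S) {u v w c d : P}
    (huv : u ≠ v) (huw : u ≠ w) (hv : CanSee S u v) (hw : CanSee S u w)
    (hfree : FreeSector S u v w)
    (huniq : ∀ a b : ℝ, a • ((v : Plane) - u) + b • ((w : Plane) - u) = 0 → a = 0 ∧ b = 0)
    (hcd : S.Adj c d) {q : Plane} (hq : q ∈ openSegment ℝ (c : Plane) d)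
    {a₀ b₀ a₁ b₁ : ℝ} (hqc : HasCoords u v w q a₀ b₀) (ha₀ : 0 < a₀) (hb₀ : 0 < b₀)
    (hle : a₀ + b₀ ≤ 1) (hc : HasCoords u v w c a₁ b₁) (hlt : a₁ + b₁ < 1) :
    0 < a₁ ∧ 0 < b₁ := by
  have huniq' : ∀ a b : ℝ, a • ((w : Plane) - u) + b • ((v : Plane) - u) = 0 → a = 0 ∧ b = 0 :=
    fun a b h => (huniq b a (by rw [add_comm]; exact h)).symm
  have h1 : a₁ ≤ 0 → 0 ≤ a₀ * b₁ - a₁ * b₀ → False := fun h h' =>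
    not_exit_side hP hS huw hw hfree huniq hcd hq hqc ha₀ hb₀ hle hc hlt h h'
  have h2 : b₁ ≤ 0 → 0 ≤ b₀ * a₁ - b₁ * a₀ → False := fun h h' =>
    not_exit_side hP hS huv hv hfree.swap huniq' hcd hq hqc.swap hb₀ ha₀ (by linarith) hc.swap
      (by linarith) h h'
  constructor
  · by_contra h
    push Not at h
    -- The determinant tells on which side of the line uq the endpoint c lies, hence which of uw and
    -- uv would be crossed. If a₁ ≤ 0 and c is on the side of v, then b₁ < 0 as well, and the exit
    -- would be through uv.
    by_cases h' : 0 ≤ a₀ * b₁ - a₁ * b₀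
    · exact h1 h h'
    · exact h2 (by nlinarith) (by nlinarith)
  · by_contra h
    push Not at h
    by_cases h' : 0 ≤ b₀ * a₁ - b₁ * a₀
    · exact h2 h h'
    · exact h1 (by nlinarith) (by nlinarith)

/-- If `u` sees `v` and `w` but these do not see each other, then among the vertices inside the
triangle `uvw` the one farthest from `vw` can be seen from `u`. -/
theorem exists_canSee_mem_triangle {m : ℕ} {P : Finset Plane} {S : SimpleGraph P}
    (hP : GeneralPosition m P) (hS : PlanarConstraints S) {u v w : P}
    (huv : u ≠ v) (huw : u ≠ w) (hvw : v ≠ w) (hv : CanSee S u v) (hw : CanSee S u w)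
    (hfree : FreeSector S u v w)
    (huniq : ∀ a b : ℝ, a • ((v : Plane) - u) + b • ((w : Plane) - u) = 0 → a = 0 ∧ b = 0)
    (hspan : ∀ p : Plane, ∃ a b : ℝ, HasCoords u v w p a b)
    (hns : ¬ CanSee S v w) :
    ∃ (z : P) (a b : ℝ), HasCoords u v w z a b ∧ 0 < a ∧ 0 < b ∧ a + b < 1 ∧ CanSee S u z ∧
      ∀ (p : P) (a' b' : ℝ), HasCoords u v w p a' b' → 0 < a' → 0 < b' → a' + b' < 1 →
        a + b ≤ a' + b' := by
  classical
  choose A B hAB using hspan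
  have hcoord : ∀ p a b, HasCoords u v w p a b → A p = a ∧ B p = b := by
    intro p a b h
    have := huniq (A p - a) (B p - b) (by
      have e : (A p - a) • ((v : Plane) - u) + (B p - b) • ((w : Plane) - u) =
        (u + A p • ((v : Plane) - u) + B p • ((w : Plane) - u)) -
        (u + a • ((v : Plane) - u) + b • ((w : Plane) - u)) := by module
      rw [e, ← hAB p, ← h, sub_self])
    constructor <;> linarith [this.1, this.2]
  have hlin : ∀ (c d : Plane) (t : ℝ), A (c + t • (d - c)) = A c + t * (A d - A c) ∧
      B (c + t • (d - c)) = B c + t * (B d - B c) := by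
    intro c d t
    apply hcoord
    unfold HasCoords
    conv_lhs => rw [hAB c, hAB d]
    module
  have key : ∀ {c d : P} {q : Plane}, S.Adj c d → q ∈ openSegment ℝ (c : Plane) d → 0 < A q →
      0 < B q → A q + B q ≤ 1 → A c + B c < 1 → 0 < A c ∧ 0 < B c := fun hcd hq h1 h2 h3 h4 =>
    endpoint_mem_triangle hP hS huv huw hv hw hfree huniq hcd hq (hAB _) h1 h2 h3 (hAB _) h4
  -- A constraint blocking vw has an endpoint strictly on the side of u, which then lies in the
  -- triangle. Otherwise both endpoints would be on the line vw, hence be v and w.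
  obtain ⟨z₀, hz₀⟩ : ∃ z : P, 0 < A z ∧ 0 < B z ∧ A z + B z < 1 := by
    unfold CanSee at hns
    push Not at hns
    obtain ⟨hnadj, c, d, hcd, q, hq⟩ := hns
    have hq1 : q ∈ openSegment ℝ (v : Plane) w := (hq.ge rfl).1
    have hq2 : q ∈ openSegment ℝ (c : Plane) d := (hq.ge rfl).2
    obtain ⟨s, hs0, hs1, hs⟩ := mem_openSegment_iff_smul.1 hq1
    obtain ⟨t, ht0, ht1, ht⟩ := mem_openSegment_iff_smul.1 hq2
    have hqc := hcoord q (1 - s) s (by unfold HasCoords; rw [hs]; module)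
    by_cases hc1 : A c + B c < 1
    · have := key hcd hq2 (by linarith) (by linarith) (by linarith) hc1
      exact ⟨c, this.1, this.2, hc1⟩
    by_cases hd1 : A d + B d < 1
    · have := key hcd.symm (by rwa [openSegment_symm]) (by linarith) (by linarith)
        (by linarith) hd1
      exact ⟨d, this.1, this.2, hd1⟩
    exfalso
    have hl := hlin c d t
    rw [← ht] at hl
    push Not at hc1 hd1
    have hsum : (1 - t) * (A c + B c - 1) + t * (A d + B d - 1) = 0 := by
      linear_combination hqc.1 + hqc.2 - hl.1 - hl.2
    have hc2 : A c + B c = 1 := by nlinarith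
    have hd2 : A d + B d = 1 := by nlinarith
    have line : ∀ p : P, A p + B p = 1 → p = v ∨ p = w := by
      intro p hp
      refine eq_or_eq_of_mem_line hP hvw (B p) ?_
      have e := hAB p
      unfold HasCoords at e
      rw [show A p = 1 - B p by linarith] at e
      conv_lhs => rw [e]
      module
    rcases line c hc2 with rfl | rfl <;> rcases line d hd2 with rfl | rfl
    · exact hcd.ne rfl
    · exact hnadj hcd
    · exact hnadj hcd.symm
    · exact hcd.ne rfl
  obtain ⟨z, hz, hmin⟩ := Finset.exists_min_image
    (Finset.univ.filter fun z : P => 0 < A z ∧ 0 < B z ∧ A z + B z < 1)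
    (fun z => A z + B z) ⟨z₀, by simpa using hz₀⟩
  simp only [Finset.mem_filter, Finset.mem_univ, true_and] at hz hmin
  refine ⟨z, A z, B z, hAB z, hz.1, hz.2.1, hz.2.2, ?_, ?_⟩
  · by_contra hns'
    unfold CanSee at hns'
    push Not at hns'
    obtain ⟨hnadj, c, d, hcd, q, hq⟩ := hns'
    have hq1 : q ∈ openSegment ℝ (u : Plane) z := (hq.ge rfl).1
    have hq2 : q ∈ openSegment ℝ (c : Plane) d := (hq.ge rfl).2
    obtain ⟨s, hs0, hs1, hs⟩ := mem_openSegment_iff_smul.1 hq1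
    obtain ⟨t, ht0, ht1, ht⟩ := mem_openSegment_iff_smul.1 hq2
    have hqs := hlin u z s
    have hu := hcoord u 0 0 (by unfold HasCoords; module)
    rw [← hs, hu.1, hu.2] at hqs
    have hqa : 0 < A q := by rw [hqs.1]; nlinarith [mul_pos hs0 hz.1]
    have hqb : 0 < B q := by rw [hqs.2]; nlinarith [mul_pos hs0 hz.2.1]
    have hql : A q + B q < A z + B z := by nlinarith [hqs.1, hqs.2, hz.1, hz.2.1]
    have hl := hlin c d t
    rw [← ht] at hl
    -- One endpoint of a constraint blocking uz is at least as far from vw as the crossing q, hence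
    -- farther than z. It lies in the triangle, against the choice of z.
    have fin : ∀ {c d : P}, S.Adj c d → q ∈ openSegment ℝ (c : Plane) d →
        A c + B c ≤ A q + B q → False := by
      intro c d hcd hq2 hle
      have := key hcd hq2 hqa hqb (by linarith [hz.2.2]) (by linarith [hz.2.2])
      have := hmin c ⟨this.1, this.2, by linarith [hz.2.2]⟩
      linarith
    by_cases hle : A c + B c ≤ A q + B q
    · exact fin hcd hq2 hle
    · refine fin hcd.symm (by rwa [openSegment_symm]) ?_
      push Not at hle
      nlinarith [hl.1, hl.2]
  · intro p a' b' hp ha' hb' hab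
    obtain ⟨rfl, rfl⟩ := hcoord p a' b' hp
    exact hmin p ⟨ha', hb', hab⟩


/-! ### Walks of bounded length -/

/-- There is a walk from `u` to `w` of length at most `ℓ`. -/
def WalkWithin {P : Finset Plane} (G : SimpleGraph P) (u w : P) (ℓ : ℝ) : Prop :=
  ∃ p : G.Walk u w, walkLength p ≤ ℓ

theorem WalkWithin.mono {P : Finset Plane} {G : SimpleGraph P} {u w : P} {a b : ℝ}
    (h : WalkWithin G u w a) (hab : a ≤ b) : WalkWithin G u w b :=
  h.imp fun _ hp => hp.trans hab

theorem WalkWithin.trans {P : Finset Plane} {G : SimpleGraph P} {u v w : P} {a b : ℝ}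
    (h : WalkWithin G u v a) (h' : WalkWithin G v w b) : WalkWithin G u w (a + b) := by
  obtain ⟨p, hp⟩ := h
  obtain ⟨q, hq⟩ := h'
  refine ⟨p.append q, ?_⟩
  have : walkLength (p.append q) = walkLength p + walkLength q := by
    simp [walkLength, SimpleGraph.Walk.darts_append]
  linarith

theorem WalkWithin.of_adj {P : Finset Plane} {G : SimpleGraph P} {u w : P} (h : G.Adj u w) :
    WalkWithin G u w (dist (u : Plane) w) :=
  ⟨h.toWalk, by simp [walkLength]⟩

theorem WalkWithin.exists_isPath {P : Finset Plane} {G : SimpleGraph P} {u w : P} {a : ℝ}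
    (h : WalkWithin G u w a) : ∃ p : G.Walk u w, p.IsPath ∧ walkLength p ≤ a := by
  classical
  obtain ⟨p, hp⟩ := h
  refine ⟨p.bypass, p.bypass_isPath, le_trans ?_ hp⟩
  refine (p.darts_bypass_sublist_darts.map _).sum_le_sum ?_
  intro x hx
  obtain ⟨e, -, rfl⟩ := List.mem_map.1 hx
  exact dist_nonneg

/-! ### The chain across a triangle -/

set_option maxHeartbeats 1000000 in
/-- Let `u` see `v` and `w`, with `v` to the left of and below `w` in the coordinates `X, Y`. If
visible pairs at small `ℓ¹`-distance are joined by walks of length at most `c` times that distance,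
then `v` and `w` are joined by a walk that is not longer than `c` times the `ℓ¹`-length of a
path in the triangle `uvw` that goes up from `v` to `w`, first to the right as far as the line
`X = M`, then to the left. -/
theorem walkWithin_triangle {m : ℕ} {P : Finset Plane} {S G : SimpleGraph P}
    (hP : GeneralPosition m P) (hS : PlanarConstraints S) (u : P) (X Y : Plane →ₗ[ℝ] ℝ)
    (hinj : ∀ p : Plane, X p = 0 → Y p = 0 → p = 0) {c N : ℝ} (hc : 0 ≤ c)
    (hN : ∀ p q : P, p ≠ q → CanSee S p q → |X ((q : Plane) - p)| + |Y ((q : Plane) - p)| < N →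
      WalkWithin G p q (c * (|X ((q : Plane) - p)| + |Y ((q : Plane) - p)|)))
    (v w : P) (hv : CanSee S u v) (hw : CanSee S u w) (hfree : FreeSector S u v w)
    (hdet : 0 < X (w - u) * Y (v - u) - X (v - u) * Y (w - u))
    (hvw : Y (v - u) < Y (w - u)) (hv0 : 0 < Y (v - u))
    (hlow : ∀ (p : P) (a b : ℝ), CanSee S u p → HasCoords u v w p a b → 0 < a → 0 < b →
      a + b < 1 → Y (v - u) < Y (p - u))
    (M : ℝ) (hvM : X (v - u) ≤ M) (hwM : X (w - u) ≤ M)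
    (hM : ∀ (p : P) (a b : ℝ), HasCoords u v w p a b → 0 < a → 0 < b → a + b < 1 → X (p - u) ≤ M)
    (hlt : Y (w - u) - Y (v - u) + (2 * M - X (v - u) - X (w - u)) < N) :
    WalkWithin G v w (c * (Y (w - u) - Y (v - u) + (2 * M - X (v - u) - X (w - u)))) := by
  classical
  -- Induction on the number of vertices strictly inside the triangle; the splitting vertex z is
  -- lost in both halves.
  obtain ⟨n, hn⟩ : ∃ n, (Finset.univ.filter fun p : P => ∃ a b : ℝ, HasCoords u v w p a b ∧ 0 < a ∧
    0 < b ∧ a + b < 1).card = n := ⟨_, rfl⟩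
  induction n using Nat.strong_induction_on generalizing v w M with
  | _ n ih =>
  have hw0 := hv0.trans hvw
  have huv : u ≠ v := by rintro rfl; simp at hdet
  have huw : u ≠ w := by rintro rfl; simp at hdet
  have hvw' : v ≠ w := by rintro rfl; exact lt_irrefl _ hvw
  by_cases hsee : CanSee S v w
  · have e : (w : Plane) - v = (w - u) - (v - u) := by abel
    have hX : |X ((w : Plane) - v)| + |Y ((w : Plane) - v)| ≤
        Y (w - u) - Y (v - u) + (2 * M - X (v - u) - X (w - u)) := by
      rw [e, map_sub, map_sub Y, abs_of_pos (sub_pos.2 hvw)]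
      have : |X (w - u) - X (v - u)| ≤ 2 * M - X (v - u) - X (w - u) := by
        rw [abs_le]; constructor <;> linarith
      linarith
    exact (hN v w hvw' hsee (hX.trans_lt hlt)).mono (mul_le_mul_of_nonneg_left hX hc)
  have huniq : ∀ a b : ℝ, a • ((v : Plane) - u) + b • ((w : Plane) - u) = 0 → a = 0 ∧ b = 0 := by
    intro a b h
    have h1 := congrArg X h
    have h2 := congrArg Y h
    simp only [map_add, map_smul, smul_eq_mul, map_zero] at h1 h2
    constructor
    · refine (mul_eq_zero.1
        (?_ : a * (X (w - u) * Y (v - u) - X (v - u) * Y (w - u)) = 0)).resolve_right hdet.ne'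
      linear_combination X (w - u) * h2 - Y (w - u) * h1
    · refine (mul_eq_zero.1
        (?_ : b * (X (w - u) * Y (v - u) - X (v - u) * Y (w - u)) = 0)).resolve_right hdet.ne'
      linear_combination Y (v - u) * h1 - X (v - u) * h2
  have hspan : ∀ p : Plane, ∃ a b : ℝ, HasCoords u v w p a b := by
    intro p
    set D := X (w - u) * Y (v - u) - X (v - u) * Y (w - u) with hD
    refine ⟨(X (w - u) * Y (p - u) - X (p - u) * Y (w - u)) / D,
      (X (p - u) * Y (v - u) - X (v - u) * Y (p - u)) / D, ?_⟩
    unfold HasCoords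
    rw [← sub_eq_zero]
    have e : ∀ a b : ℝ, p - ((u : Plane) + a • ((v : Plane) - u) + b • ((w : Plane) - u)) =
      (p - u) - a • ((v : Plane) - u) - b • ((w : Plane) - u) := by intro a b; module
    rw [e]
    apply hinj
    · rw [map_sub, map_sub X (p - u), map_smul, map_smul, smul_eq_mul, smul_eq_mul]
      have := hdet.ne'
      field_simp
      rw [hD]; ring
    · rw [map_sub, map_sub Y (p - u), map_smul, map_smul, smul_eq_mul, smul_eq_mul]
      have := hdet.ne'
      field_simp
      rw [hD]; ring
  obtain ⟨z, a, b, hz, ha, hb, hab, hsz, hmin⟩ :=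
    exists_canSee_mem_triangle hP hS huv huw hvw' hv hw hfree huniq hspan hsee
  have hcX : ∀ {v w p : Plane} {a b : ℝ}, HasCoords u v w p a b →
      X (p - u) = a * X (v - u) + b * X (w - u) := by
    intro v w p a b h
    have : p - u = a • (v - (u : Plane)) + b • (w - (u : Plane)) := by rw [h]; module
    rw [this]; simp only [map_add, map_smul, smul_eq_mul]
  have hcY : ∀ {v w p : Plane} {a b : ℝ}, HasCoords u v w p a b →
      Y (p - u) = a * Y (v - u) + b * Y (w - u) := by
    intro v w p a b h
    have : p - u = a • (v - (u : Plane)) + b • (w - (u : Plane)) := by rw [h]; module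
    rw [this]; simp only [map_add, map_smul, smul_eq_mul]
  have hleft : ∀ {p : Plane} {s t : ℝ}, HasCoords u v z p s t →
      HasCoords u v w p (s + t * a) (t * b) := by
    intro p s t h
    unfold HasCoords at *
    rw [h]; conv_lhs => rw [hz]
    module
  have hright : ∀ {p : Plane} {s t : ℝ}, HasCoords u z w p s t →
      HasCoords u v w p (s * a) (s * b + t) := by
    intro p s t h
    unfold HasCoords at *
    rw [h]; conv_lhs => rw [hz]
    module
  have hzX := hcX hz
  have hzY := hcY hz
  have hYz := hlow z a b hsz hz ha hb hab
  have hXz := hM z a b hz ha hb hab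
  have hinL : ∀ {p : P} {s t : ℝ}, HasCoords u v z p s t → 0 < s → 0 < t → s + t < 1 →
      0 < s + t * a ∧ 0 < t * b ∧ s + t * a + t * b < 1 := by
    intro p s t h hs ht hst
    refine ⟨by positivity, by positivity, by nlinarith⟩
  have hinR : ∀ {p : P} {s t : ℝ}, HasCoords u z w p s t → 0 < s → 0 < t → s + t < 1 →
      0 < s * a ∧ 0 < s * b + t ∧ s * a + (s * b + t) < 1 := by
    intro p s t h hs ht hst
    refine ⟨by positivity, by positivity, by nlinarith⟩
  have hzmem : z ∈ Finset.univ.filter fun p : P => ∃ a b : ℝ, HasCoords u v w p a b ∧ 0 < a ∧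
    0 < b ∧ a + b < 1 := by simpa using ⟨a, b, hz, ha, hb, hab⟩
  have hdL : 0 < X (z - u) * Y (v - u) - X (v - u) * Y (z - u) := by
    rw [hzX, hzY]
    have := mul_pos hb hdet
    linarith
  have hdR : 0 < X (w - u) * Y (z - u) - X (z - u) * Y (w - u) := by
    rw [hzX, hzY]
    have := mul_pos ha hdet
    linarith
  have hfL : FreeSector S u v z := fun c hc s t hs ht h =>
    hfree c hc _ _ (by positivity) (by positivity) (hleft h)
  have hfR : FreeSector S u z w := fun c hc s t hs ht h =>
    hfree c hc _ _ (by positivity) (by positivity) (hright h)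
  have hYzw : Y (z - u) < Y (w - u) := by rw [hzY]; nlinarith
  have cardL : ∀ m, (Finset.univ.filter fun p : P => ∃ a b : ℝ, HasCoords u v z p a b ∧ 0 < a ∧
      0 < b ∧ a + b < 1).card = m → m < n := by
    rintro m rfl
    rw [← hn]
    apply Finset.card_lt_card
    refine (Finset.ssubset_iff_of_subset ?_).2 ⟨z, hzmem, ?_⟩
    · intro p hp
      simp only [Finset.mem_filter, Finset.mem_univ, true_and] at hp ⊢
      obtain ⟨s, t, h, hs, ht, hst⟩ := hp
      exact ⟨_, _, hleft h, hinL h hs ht hst⟩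
    · simp only [Finset.mem_filter, Finset.mem_univ, true_and]
      rintro ⟨s, t, h, hs, ht, hst⟩
      have h1 := hcX h
      have h2 := hcY h
      have : s * (X (z - u) * Y (v - u) - X (v - u) * Y (z - u)) = 0 := by
        linear_combination X (z - u) * -h2 + Y (z - u) * h1
      rcases mul_eq_zero.1 this with h | h <;> linarith
  have cardR : ∀ m, (Finset.univ.filter fun p : P => ∃ a b : ℝ, HasCoords u z w p a b ∧ 0 < a ∧
      0 < b ∧ a + b < 1).card = m → m < n := by
    rintro m rfl
    rw [← hn]
    apply Finset.card_lt_card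
    refine (Finset.ssubset_iff_of_subset ?_).2 ⟨z, hzmem, ?_⟩
    · intro p hp
      simp only [Finset.mem_filter, Finset.mem_univ, true_and] at hp ⊢
      obtain ⟨s, t, h, hs, ht, hst⟩ := hp
      exact ⟨_, _, hright h, hinR h hs ht hst⟩
    · simp only [Finset.mem_filter, Finset.mem_univ, true_and]
      rintro ⟨s, t, h, hs, ht, hst⟩
      have h1 := hcX h
      have h2 := hcY h
      have : t * (X (w - u) * Y (z - u) - X (z - u) * Y (w - u)) = 0 := by
        linear_combination Y (z - u) * -h1 + X (z - u) * h2
      rcases mul_eq_zero.1 this with h | h <;> linarith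
  have lowL : ∀ (p : P) (s t : ℝ), CanSee S u p → HasCoords u v z p s t → 0 < s → 0 < t →
      s + t < 1 → Y (v - u) < Y (p - u) := by
    intro p s t hp h hs ht hst
    have := hinL h hs ht hst
    exact hlow p _ _ hp (hleft h) this.1 this.2.1 this.2.2
  have lowR : ∀ (p : P) (s t : ℝ), CanSee S u p → HasCoords u z w p s t → 0 < s → 0 < t →
      s + t < 1 → Y (z - u) < Y (p - u) := by
    intro p s t hp h hs ht hst
    have h1 := hinR h hs ht hst
    have h2 := hmin p _ _ (hright h) h1.1 h1.2.1 h1.2.2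
    have h3 := hcY h
    -- By the choice of z, p is not on the side of u of the parallel to vw through z. It is reached
    -- from z by going along this parallel towards w, then along the direction uw; the first move
    -- raises `Y` and the second does not lower it.
    have h4 : Y (p - u) - Y (z - u) =
        (t - (a + b) * (1 - s)) * Y (w - u) + (1 - s) * a * (Y (w - u) - Y (v - u)) := by
      rw [h3, hzY]; ring
    have h5 : 0 ≤ t - (a + b) * (1 - s) := by nlinarith
    have h6 : 0 < (1 - s) * a * (Y (w - u) - Y (v - u)) :=
      mul_pos (mul_pos (by linarith) ha) (by linarith)
    nlinarith [mul_nonneg h5 hw0.le]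
  have hab' : 0 < 1 - (a + b) := by linarith
  -- Only one half keeps the turning line `X = M`: the right one if v is left of w, otherwise the
  -- left one. The other half turns at z itself and so is monotone in both coordinates; the two
  -- lengths add up exactly.
  rcases le_or_gt (X (v - u)) (X (w - u)) with hX | hX
  · have hXvz : X (v - u) ≤ X (z - u) := by
      by_contra hcon
      push Not at hcon
      have hYvw : 0 < Y (w - u) - Y (v - u) := by linarith
      have e : (X (w - u) - X (v - u)) * (Y (z - u) - Y (v - u)) -
          (Y (w - u) - Y (v - u)) * (X (z - u) - X (v - u)) =
          -((1 - (a + b)) * (X (w - u) * Y (v - u) - X (v - u) * Y (w - u))) := by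
        rw [hzX, hzY]; ring
      have := mul_pos hab' hdet
      nlinarith
    have hML : ∀ (p : P) (s t : ℝ), HasCoords u v z p s t → 0 < s → 0 < t → s + t < 1 →
        X (p - u) ≤ X (z - u) := by
      intro p s t h hs ht hst
      have h1 := hinL h hs ht hst
      have h2 := hmin p _ _ (hleft h) h1.1 h1.2.1 h1.2.2
      have h3 := hcX h
      have h5 : 0 ≤ s - (a + b) * (1 - t) := by nlinarith
      -- The part of the triangle uvz not nearer to u than the parallel to vw through z is a
      -- triangle with vertices v, z and u + (a + b)(v - u). None of them is to the right of z, and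
      -- the identity gives the barycentric weights of p. The other case is the mirror image.
      have e : (1 - (a + b)) * (X (p - u) - X (z - u)) =
          (s - (a + b) * (1 - t)) * (X (v - u) - X (z - u)) +
          (1 - t - s) * (b * (X (v - u) - X (w - u))) := by
        rw [h3, hzX]; ring
      have h6 : (s - (a + b) * (1 - t)) * (X (v - u) - X (z - u)) ≤ 0 :=
        mul_nonpos_of_nonneg_of_nonpos h5 (by linarith)
      have h7 : (1 - t - s) * (b * (X (v - u) - X (w - u))) ≤ 0 :=
        mul_nonpos_of_nonneg_of_nonpos (by linarith)
          (mul_nonpos_of_nonneg_of_nonpos hb.le (by linarith))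
      nlinarith
    have A := ih _ (cardL _ rfl) v z hv hsz hfL hdL hYz hv0 lowL (X (z - u)) hXvz le_rfl
      hML (by linarith) rfl
    have B := ih _ (cardR _ rfl) z w hsz hw hfR hdR hYzw (hv0.trans hYz) lowR M hXz hwM
      (fun p s t h hs ht hst => by
        have := hinR h hs ht hst
        exact hM p _ _ (hright h) this.1 this.2.1 this.2.2) (by linarith) rfl
    exact (A.trans B).mono (le_of_eq (by ring))
  · have hXwz : X (w - u) ≤ X (z - u) := by
      by_contra hcon
      push Not at hcon
      have e : (X (w - u) - X (z - u)) * (Y (w - u) - Y (v - u)) -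
          (Y (w - u) - Y (z - u)) * (X (w - u) - X (v - u)) =
          -((1 - (a + b)) * (X (w - u) * Y (v - u) - X (v - u) * Y (w - u))) := by
        rw [hzX, hzY]; ring
      have := mul_pos hab' hdet
      nlinarith
    have hMR : ∀ (p : P) (s t : ℝ), HasCoords u z w p s t → 0 < s → 0 < t → s + t < 1 →
        X (p - u) ≤ X (z - u) := by
      intro p s t h hs ht hst
      have h1 := hinR h hs ht hst
      have h2 := hmin p _ _ (hright h) h1.1 h1.2.1 h1.2.2
      have h3 := hcX h
      have h5 : 0 ≤ t - (a + b) * (1 - s) := by nlinarith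
      have e : (1 - (a + b)) * (X (p - u) - X (z - u)) =
          (t - (a + b) * (1 - s)) * (X (w - u) - X (z - u)) +
          (1 - s - t) * (a * (X (w - u) - X (v - u))) := by
        rw [h3, hzX]; ring
      have h6 : (t - (a + b) * (1 - s)) * (X (w - u) - X (z - u)) ≤ 0 :=
        mul_nonpos_of_nonneg_of_nonpos h5 (by linarith)
      have h7 : (1 - s - t) * (a * (X (w - u) - X (v - u))) ≤ 0 :=
        mul_nonpos_of_nonneg_of_nonpos (by linarith)
          (mul_nonpos_of_nonneg_of_nonpos ha.le (by linarith))
      nlinarith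
    have A := ih _ (cardL _ rfl) v z hv hsz hfL hdL hYz hv0 lowL M hvM hXz
      (fun p s t h hs ht hst => by
        have := hinL h hs ht hst
        exact hM p _ _ (hleft h) this.1 this.2.1 this.2.2) (by linarith) rfl
    have B := ih _ (cardR _ rfl) z w hsz hw hfR hdR hYzw (hv0.trans hYz) lowR (X (z - u)) le_rfl hXwz
      hMR (by linarith) rfl
    exact (A.trans B).mono (le_of_eq (by ring))


/-! ### Frames of the cones -/

/-- The coordinate perpendicular to the bisector of the `i`-th cone. -/
noncomputable def frameX (m : ℕ) (i : ℤ) : Plane →ₗ[ℝ] ℝ where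
  toFun p := p 0 * Real.cos (i * aperture m) - p 1 * Real.sin (i * aperture m)
  map_add' p q := by simp; ring
  map_smul' t p := by simp; ring

/-- The coordinate along the bisector of the `i`-th cone. -/
noncomputable def frameY (m : ℕ) (i : ℤ) : Plane →ₗ[ℝ] ℝ where
  toFun p := p 0 * Real.sin (i * aperture m) + p 1 * Real.cos (i * aperture m)
  map_add' p q := by simp; ring
  map_smul' t p := by simp; ring

theorem frameX_apply (m : ℕ) (i : ℤ) (p : Plane) :
    frameX m i p = p 0 * Real.cos (i * aperture m) - p 1 * Real.sin (i * aperture m) := rfl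

theorem frameY_apply (m : ℕ) (i : ℤ) (p : Plane) :
    frameY m i p = p 0 * Real.sin (i * aperture m) + p 1 * Real.cos (i * aperture m) := rfl

theorem inner_bisector (m : ℕ) (i : ℤ) (p : Plane) :
    inner ℝ p (bisector m i) = frameY m i p := by
  simp [bisector, dir, frameY_apply, PiLp.inner_apply]; ring

theorem frame_injective (m : ℕ) (i : ℤ) (p : Plane) (hX : frameX m i p = 0)
    (hY : frameY m i p = 0) : p = 0 := by
  rw [frameX_apply] at hX
  rw [frameY_apply] at hY
  have h := Real.sin_sq_add_cos_sq (i * aperture m)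
  ext j
  fin_cases j
  · change p 0 = 0
    linear_combination Real.cos (i * aperture m) * hX + Real.sin (i * aperture m) * hY - p 0 * h
  · change p 1 = 0
    linear_combination Real.cos (i * aperture m) * hY - Real.sin (i * aperture m) * hX - p 1 * h

theorem norm_sq_eq_frame (m : ℕ) (i : ℤ) (p : Plane) :
    ‖p‖ ^ 2 = frameX m i p ^ 2 + frameY m i p ^ 2 := by
  rw [EuclideanSpace.norm_sq_eq, frameX_apply, frameY_apply]
  simp only [Fin.sum_univ_two, Real.norm_eq_abs, sq_abs]
  have h := Real.sin_sq_add_cos_sq (i * aperture m)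
  linear_combination -(p 0 ^ 2 + p 1 ^ 2) * h

/-- The cross product is the determinant in any of the frames. -/
theorem cross_eq_frame (m : ℕ) (i : ℤ) (p q : Plane) :
    cross p q = frameX m i p * frameY m i q - frameY m i p * frameX m i q := by
  unfold cross
  rw [frameX_apply, frameY_apply, frameX_apply, frameY_apply]
  have h := Real.sin_sq_add_cos_sq (i * aperture m)
  linear_combination -(p 0 * q 1 - p 1 * q 0) * h

theorem frameX_dir (m : ℕ) (i : ℤ) (φ : ℝ) :
    frameX m i (dir φ) = Real.sin (φ - i * aperture m) := by
  rw [frameX_apply, Real.sin_sub]; simp [dir]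

theorem frameY_dir (m : ℕ) (i : ℤ) (φ : ℝ) :
    frameY m i (dir φ) = Real.cos (φ - i * aperture m) := by
  rw [frameY_apply, Real.cos_sub]; simp [dir]; ring

theorem frameX_ray (m : ℕ) (i : ℤ) : frameX m i (ray m i) = -Real.sin (aperture m / 2) := by
  rw [ray, frameX_dir, ← Real.sin_neg]; congr 1; ring

theorem frameY_ray (m : ℕ) (i : ℤ) : frameY m i (ray m i) = Real.cos (aperture m / 2) := by
  rw [ray, frameY_dir, ← Real.cos_neg]; congr 1; ring

theorem frameX_ray_succ (m : ℕ) (i : ℤ) :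
    frameX m i (ray m (i + 1)) = Real.sin (aperture m / 2) := by
  rw [ray, frameX_dir]; congr 1; push_cast; ring

theorem frameY_ray_succ (m : ℕ) (i : ℤ) :
    frameY m i (ray m (i + 1)) = Real.cos (aperture m / 2) := by
  rw [ray, frameY_dir]; congr 1; push_cast; ring

theorem eq_of_frame_eq {m : ℕ} (i : ℤ) {p q : Plane} (hX : frameX m i p = frameX m i q)
    (hY : frameY m i p = frameY m i q) : p = q :=
  sub_eq_zero.1 (frame_injective m i _ (by rw [map_sub, hX, sub_self])
    (by rw [map_sub, hY, sub_self]))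

/-- In the frame of its cone, membership is a symmetric slope bound; the coefficients on the two
rays come from solving a 2×2 linear system. -/
theorem mem_cone_iff {m : ℕ} (hs : 0 < Real.sin (aperture m / 2))
    (hc : 0 < Real.cos (aperture m / 2)) (i : ℤ) (u p : Plane) :
    p ∈ cone m i u ↔ |frameX m i (p - u)| * Real.cos (aperture m / 2) ≤
      frameY m i (p - u) * Real.sin (aperture m / 2) := by
  set σ := Real.sin (aperture m / 2) with hσ
  set κ := Real.cos (aperture m / 2) with hκ
  constructor
  · rintro ⟨s, t, hs', ht', rfl⟩
    have e : u + s • ray m i + t • ray m (i + 1) - u = s • ray m i + t • ray m (i + 1) := by abel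
    rw [e, map_add, map_add (frameY m i)]
    simp only [map_smul, frameX_ray, frameX_ray_succ, frameY_ray, frameY_ray_succ, smul_eq_mul,
      ← hσ, ← hκ]
    have : |s * -σ + t * σ| ≤ (s + t) * σ := by
      rw [abs_le]; constructor <;> nlinarith [mul_nonneg hs' hs.le, mul_nonneg ht' hs.le]
    calc _ ≤ (s + t) * σ * κ := mul_le_mul_of_nonneg_right this hc.le
      _ = _ := by ring
  · intro h
    have h1 := abs_le.1 (le_of_eq (abs_mul (frameX m i (p - u)) κ))
    rw [abs_of_pos hc] at h1
    refine ⟨(frameY m i (p - u) / κ - frameX m i (p - u) / σ) / 2,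
      (frameY m i (p - u) / κ + frameX m i (p - u) / σ) / 2, ?_, ?_, ?_⟩
    · have : frameX m i (p - u) / σ ≤ frameY m i (p - u) / κ := by
        rw [div_le_div_iff₀ hs hc]; linarith
      linarith
    · have : -frameX m i (p - u) / σ ≤ frameY m i (p - u) / κ := by
        rw [div_le_div_iff₀ hs hc]; linarith
      rw [neg_div] at this
      linarith
    · have key : p - u = ((frameY m i (p - u) / κ - frameX m i (p - u) / σ) / 2) • ray m i +
          ((frameY m i (p - u) / κ + frameX m i (p - u) / σ) / 2) • ray m (i + 1) := by
        apply eq_of_frame_eq (m := m) i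
        · conv_rhs => rw [map_add, map_smul, map_smul, frameX_ray, frameX_ray_succ, ← hσ]
          simp only [smul_eq_mul]
          have := hs.ne'
          field_simp
          ring
        · conv_rhs => rw [map_add, map_smul, map_smul, frameY_ray, frameY_ray_succ, ← hκ]
          simp only [smul_eq_mul]
          have := hc.ne'
          field_simp
          ring
      rw [add_assoc, ← key]
      abel

/-! ### Polar angles and the ℓ¹-norm in different frames -/

/-- Polar coordinates. -/
theorem exists_polar (x y : ℝ) : ∃ r φ : ℝ, 0 ≤ r ∧ φ ∈ Set.Ioc (-Real.pi) Real.pi ∧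
    x = r * Real.sin φ ∧ y = r * Real.cos φ := by
  refine ⟨‖(⟨y, x⟩ : ℂ)‖, Complex.arg ⟨y, x⟩, norm_nonneg _, Complex.arg_mem_Ioc _, ?_, ?_⟩
  · rw [Complex.norm_mul_sin_arg]
  · rw [Complex.norm_mul_cos_arg]

/-- A vector of a cone has polar angle at most half the aperture. -/
theorem exists_polar_of_le {h x y : ℝ} (h0 : 0 < h) (h1 : h < Real.pi / 2)
    (hxy : |x| * Real.cos h ≤ y * Real.sin h) :
    ∃ r ψ : ℝ, 0 ≤ r ∧ |ψ| ≤ h ∧ x = r * Real.sin ψ ∧ y = r * Real.cos ψ := by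
  have hs : 0 < Real.sin h := Real.sin_pos_of_pos_of_lt_pi h0 (by linarith [Real.pi_pos])
  have hc : 0 < Real.cos h := Real.cos_pos_of_mem_Ioo ⟨by linarith, h1⟩
  obtain ⟨r, ψ, hr, ⟨hψ1, hψ2⟩, hx, hy⟩ := exists_polar x y
  rcases hr.eq_or_lt with rfl | hr
  · exact ⟨0, 0, le_rfl, by simpa using h0.le, by simpa using hx, by simpa using hy⟩
  refine ⟨r, ψ, hr.le, ?_, hx, hy⟩
  have hle := abs_le.1 (le_of_eq (abs_mul x (Real.cos h)))
  rw [abs_of_pos hc] at hle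
  have e1 : 0 ≤ Real.sin (h - ψ) := by
    have : 0 ≤ r * Real.sin (h - ψ) := by
      have : r * Real.sin (h - ψ) = y * Real.sin h - x * Real.cos h := by
        rw [Real.sin_sub, hx, hy]; ring
      linarith
    exact nonneg_of_mul_nonneg_right this hr
  have e2 : 0 ≤ Real.sin (h + ψ) := by
    have : 0 ≤ r * Real.sin (h + ψ) := by
      have : r * Real.sin (h + ψ) = y * Real.sin h + x * Real.cos h := by
        rw [Real.sin_add, hx, hy]; ring
      linarith
    exact nonneg_of_mul_nonneg_right this hr
  have hy0 : 0 ≤ y := by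
    have : 0 ≤ y * Real.sin h := le_trans (by positivity) hxy
    exact nonneg_of_mul_nonneg_left this hs
  have hcψ : 0 ≤ Real.cos ψ := by
    rw [hy] at hy0; exact nonneg_of_mul_nonneg_right hy0 hr
  have hψ3 : ψ ≤ Real.pi / 2 := by
    by_contra hh
    push Not at hh
    exact absurd (Real.cos_neg_of_pi_div_two_lt_of_lt hh (by linarith)) (not_lt.2 hcψ)
  have hψ4 : -(Real.pi / 2) ≤ ψ := by
    by_contra hh
    push Not at hh
    rw [← Real.cos_neg] at hcψ
    exact absurd (Real.cos_neg_of_pi_div_two_lt_of_lt (x := -ψ) (by linarith) (by linarith))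
      (not_lt.2 hcψ)
  rw [abs_le]
  constructor
  · by_contra hh
    push Not at hh
    exact absurd (Real.sin_neg_of_neg_of_neg_pi_lt (x := h + ψ) (by linarith) (by linarith))
      (not_lt.2 e2)
  · by_contra hh
    push Not at hh
    exact absurd (Real.sin_neg_of_neg_of_neg_pi_lt (x := h - ψ) (by linarith) (by linarith))
      (not_lt.2 e1)

/-- Among the angles `x + 2πn/K` the one in `[-π/K, π/K]` has the largest cosine. -/
theorem cos_add_le_cos {K : ℕ} (hK : 0 < K) {x : ℝ} (hx : |x| ≤ Real.pi / K) (n : ℤ) :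
    Real.cos (x + n * (2 * Real.pi / K)) ≤ Real.cos x := by
  have hK' : (0 : ℝ) < K := by exact_mod_cast hK
  obtain ⟨q, j, hj0, hj1, hn⟩ : ∃ q j : ℤ, 0 ≤ j ∧ j < K ∧ n = j + K * q :=
    ⟨n / K, n % K, Int.emod_nonneg _ (by omega), Int.emod_lt_of_pos _ (by omega),
      (Int.emod_add_mul_ediv n K).symm⟩
  have e : x + n * (2 * Real.pi / K) = x + j * (2 * Real.pi / K) + q * (2 * Real.pi) := by
    rw [hn]; push_cast; field_simp; ring
  rw [e, Real.cos_add_int_mul_two_pi]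
  rcases hj0.eq_or_lt with rfl | hj0
  · simp
  rw [← sub_nonneg, Real.cos_sub_cos]
  have hj0' : (1 : ℝ) ≤ j := by exact_mod_cast hj0
  have hj1' : (j : ℝ) + 1 ≤ K := by exact_mod_cast hj1
  set π' := Real.pi / K with hπ
  have hp : 0 < π' := by positivity
  have hKp : K * π' = Real.pi := by rw [hπ]; field_simp
  have e1 : (x + (x + j * (2 * Real.pi / K))) / 2 = x + j * π' := by rw [hπ]; ring
  have e2 : (x - (x + j * (2 * Real.pi / K))) / 2 = -(j * π') := by rw [hπ]; ring
  -- The difference of cosines is 2 sin (x + jπ/K) sin (jπ/K). Both angles are in [0, π] because 1 ≤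
  -- j ≤ K - 1 and |x| ≤ π/K.
  rw [e1, e2, Real.sin_neg]
  obtain ⟨hx1, hx2⟩ := abs_le.1 hx
  have s1 : 0 ≤ Real.sin (x + j * π') :=
    Real.sin_nonneg_of_nonneg_of_le_pi (by nlinarith) (by nlinarith)
  have s2 : 0 ≤ Real.sin (j * π') :=
    Real.sin_nonneg_of_nonneg_of_le_pi (by nlinarith) (by nlinarith)
  nlinarith [mul_nonneg s1 s2]

theorem frameX_eq_rotate (m : ℕ) (i j : ℤ) (p : Plane) :
    frameX m j p = frameX m i p * Real.cos (((i - j : ℤ) : ℝ) * aperture m) +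
      frameY m i p * Real.sin (((i - j : ℤ) : ℝ) * aperture m) := by
  rw [frameX_apply, frameX_apply, frameY_apply]
  have e : (j : ℝ) * aperture m = i * aperture m - ((i - j : ℤ) : ℝ) * aperture m := by
    push_cast; ring
  rw [e, Real.cos_sub, Real.sin_sub]
  ring

theorem frameY_eq_rotate (m : ℕ) (i j : ℤ) (p : Plane) :
    frameY m j p = frameY m i p * Real.cos (((i - j : ℤ) : ℝ) * aperture m) -
      frameX m i p * Real.sin (((i - j : ℤ) : ℝ) * aperture m) := by
  rw [frameY_apply, frameX_apply, frameY_apply]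
  have e : (j : ℝ) * aperture m = i * aperture m - ((i - j : ℤ) : ℝ) * aperture m := by
    push_cast; ring
  rw [e, Real.cos_sub, Real.sin_sub]
  ring

theorem aperture_half_eq (k : ℕ) : aperture (4 * k + 4) / 2 = Real.pi / (4 * (k + 1)) := by
  unfold aperture; push_cast; field_simp

theorem aperture_half_pos (k : ℕ) : 0 < aperture (4 * k + 4) / 2 := by
  rw [aperture_half_eq]; have := Real.pi_pos; positivity

theorem aperture_half_lt {k : ℕ} (hk : 1 ≤ k) : aperture (4 * k + 4) / 2 < Real.pi / 4 := by
  rw [aperture_half_eq]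
  have : (1 : ℝ) ≤ k := by exact_mod_cast hk
  apply div_lt_div_of_pos_left Real.pi_pos <;> linarith

/-- The `ℓ¹`-norm of a vector is smallest in the frame of the cone that contains it. -/
theorem frame_l1_le {k : ℕ} (hk : 1 ≤ k) (i j : ℤ) (u p : Plane)
    (hp : p ∈ cone (4 * k + 4) i u) :
    |frameX (4 * k + 4) i (p - u)| + |frameY (4 * k + 4) i (p - u)| ≤
      |frameX (4 * k + 4) j (p - u)| + |frameY (4 * k + 4) j (p - u)| := by
  have h0 := aperture_half_pos k
  have h1 := aperture_half_lt hk
  have hπ := Real.pi_pos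
  have hs := Real.sin_pos_of_pos_of_lt_pi h0 (by linarith)
  have hc : 0 < Real.cos (aperture (4 * k + 4) / 2) :=
    Real.cos_pos_of_mem_Ioo ⟨by linarith, by linarith⟩
  rw [mem_cone_iff hs hc] at hp
  have eX := frameX_eq_rotate (4 * k + 4) i j (p - u)
  have eY := frameY_eq_rotate (4 * k + 4) i j (p - u)
  obtain ⟨r, ψ, hr, hψ, hx, hy⟩ := exists_polar_of_le h0 (by linarith) hp
  set n := i - j
  have eX' : frameX (4 * k + 4) j (p - u) = r * Real.sin (ψ + n * aperture (4 * k + 4)) := by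
    rw [eX, hx, hy, Real.sin_add]; ring
  have eY' : frameY (4 * k + 4) j (p - u) = r * Real.cos (ψ + n * aperture (4 * k + 4)) := by
    rw [eY, hx, hy, Real.cos_add]; ring
  -- The squared ℓ¹-norm at polar angle t is r² (1 + |sin 2t|), which decreases as cos 4t grows. As
  -- 4θ = 2π/(k + 1) and |4ψ| ≤ π/(k + 1), the cone's own frame maximizes this cosine.
  have hcos : Real.cos (4 * (ψ + n * aperture (4 * k + 4))) ≤ Real.cos (4 * ψ) := by
    have e : 4 * (ψ + n * aperture (4 * k + 4)) =
        4 * ψ + n * (2 * Real.pi / ((k + 1 : ℕ) : ℝ)) := by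
      unfold aperture; push_cast; field_simp
    rw [e]
    apply cos_add_le_cos (by omega)
    rw [abs_mul, abs_of_pos (by norm_num : (0 : ℝ) < 4)]
    rw [aperture_half_eq] at hψ
    have : Real.pi / ((k + 1 : ℕ) : ℝ) = 4 * (Real.pi / (4 * (k + 1))) := by
      push_cast; field_simp
    rw [this]
    linarith
  have four : ∀ t : ℝ, Real.cos (4 * t) = 1 - 8 * (Real.sin t * Real.cos t) ^ 2 := by
    intro t
    rw [show 4 * t = 2 * (2 * t) by ring, Real.cos_two_mul, Real.cos_two_mul]
    have := Real.sin_sq_add_cos_sq t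
    have e : Real.sin t ^ 2 = 1 - Real.cos t ^ 2 := by linarith
    rw [mul_pow, e]; ring
  rw [four, four] at hcos
  rw [eX', eY', hx, hy]
  simp only [abs_mul, abs_of_nonneg hr, ← mul_add]
  refine mul_le_mul_of_nonneg_left ?_ hr
  refine abs_le_of_sq_le_sq' ?_ (by positivity) |>.2
  have habs : |Real.sin ψ * Real.cos ψ| ≤
      |Real.sin (ψ + n * aperture (4 * k + 4)) * Real.cos (ψ + n * aperture (4 * k + 4))| :=
    sq_le_sq.1 (by linarith)
  rw [abs_mul, abs_mul] at habs
  have q : ∀ t : ℝ, (|Real.sin t| + |Real.cos t|) ^ 2 = 1 + 2 * (|Real.sin t| * |Real.cos t|) := by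
    intro t
    have := Real.sin_sq_add_cos_sq t
    rw [← sq_abs (Real.sin t), ← sq_abs (Real.cos t)] at this
    linarith [add_sq (|Real.sin t|) (|Real.cos t|)]
  rw [q, q]
  linarith

theorem exists_mem_cone {k : ℕ} (hk : 1 ≤ k) (u p : Plane) :
    ∃ i : ℤ, p ∈ cone (4 * k + 4) i u := by
  have h0 := aperture_half_pos k
  have h1 := aperture_half_lt hk
  have hπ := Real.pi_pos
  have hs := Real.sin_pos_of_pos_of_lt_pi h0 (by linarith)
  have hc : 0 < Real.cos (aperture (4 * k + 4) / 2) :=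
    Real.cos_pos_of_mem_Ioo ⟨by linarith, by linarith⟩
  obtain ⟨r, φ, hr, -, hx, hy⟩ := exists_polar ((p - u) 0) ((p - u) 1)
  refine ⟨round (φ / aperture (4 * k + 4)), ?_⟩
  rw [mem_cone_iff hs hc, frameX_apply, frameY_apply, hx, hy]
  set θ := aperture (4 * k + 4)
  have hr' := abs_sub_round (φ / θ)
  set i : ℤ := round (φ / θ)
  have hε : |φ - i * θ| ≤ θ / 2 := by
    have hθ : 0 < θ := by linarith
    have : φ - i * θ = (φ / θ - i) * θ := by field_simp
    rw [this, abs_mul, abs_of_pos hθ]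
    nlinarith
  obtain ⟨ha, hb⟩ := abs_le.1 hε
  have eX : r * Real.sin φ * Real.cos (i * θ) - r * Real.cos φ * Real.sin (i * θ) =
      r * Real.sin (φ - i * θ) := by rw [Real.sin_sub]; ring
  have eY : r * Real.sin φ * Real.sin (i * θ) + r * Real.cos φ * Real.cos (i * θ) =
      r * Real.cos (φ - i * θ) := by rw [Real.cos_sub]; ring
  rw [eX, eY]
  set ε := φ - i * θ
  have s1 : 0 ≤ Real.sin (θ / 2 - ε) :=
    Real.sin_nonneg_of_nonneg_of_le_pi (by linarith) (by linarith)
  have s2 : 0 ≤ Real.sin (θ / 2 + ε) :=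
    Real.sin_nonneg_of_nonneg_of_le_pi (by linarith) (by linarith)
  rw [Real.sin_sub] at s1
  rw [Real.sin_add] at s2
  rw [abs_mul, abs_of_nonneg hr, mul_assoc, mul_assoc]
  refine mul_le_mul_of_nonneg_left ?_ hr
  rcases abs_cases (Real.sin ε) with ⟨h, -⟩ | ⟨h, -⟩ <;> rw [h] <;> linarith

/-- A vector of a cone is not longer than the bound given by its coordinates in that cone, even
if its horizontal coordinate is counted negatively. -/
theorem norm_mul_le_of_mem_cone {k : ℕ} (hk : 1 ≤ k) {i : ℤ} {u p : Plane}
    (hp : p ∈ cone (4 * k + 4) i u) :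
    ‖p - u‖ * (Real.cos (aperture (4 * k + 4) / 2) - Real.sin (aperture (4 * k + 4) / 2)) ≤
      frameY (4 * k + 4) i (p - u) - |frameX (4 * k + 4) i (p - u)| := by
  have h0 := aperture_half_pos k
  have h1 := aperture_half_lt hk
  have hπ := Real.pi_pos
  have hs := Real.sin_pos_of_pos_of_lt_pi h0 (by linarith)
  have hc : 0 < Real.cos (aperture (4 * k + 4) / 2) :=
    Real.cos_pos_of_mem_Ioo ⟨by linarith, by linarith⟩
  rw [mem_cone_iff hs hc] at hp
  obtain ⟨r, ψ, hr, hψ, hx, hy⟩ := exists_polar_of_le h0 (by linarith) hp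
  have hn : ‖p - u‖ = r := by
    have := norm_sq_eq_frame (4 * k + 4) i (p - u)
    rw [hx, hy] at this
    have e : ‖p - u‖ ^ 2 = r ^ 2 := by
      rw [this]; linear_combination r ^ 2 * Real.sin_sq_add_cos_sq ψ
    exact (pow_left_inj₀ (norm_nonneg _) hr two_ne_zero).1 e
  rw [hn, hx, hy, abs_mul, abs_of_nonneg hr, ← mul_sub]
  refine mul_le_mul_of_nonneg_left ?_ hr
  have hcos : Real.cos (aperture (4 * k + 4) / 2) ≤ Real.cos ψ := by
    rw [← Real.cos_abs ψ]
    exact Real.cos_le_cos_of_nonneg_of_le_pi (abs_nonneg _) (by linarith) hψ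
  have hsin : |Real.sin ψ| ≤ Real.sin (aperture (4 * k + 4) / 2) := by
    rw [Real.abs_sin_eq_sin_abs_of_abs_le_pi (by linarith)]
    exact Real.sin_le_sin_of_le_of_le_pi_div_two (by linarith [abs_nonneg ψ]) (by linarith) hψ
  linarith


/-! ### Subcones -/

theorem cross_add_smul_right (p q r : Plane) (t : ℝ) :
    cross p (q + t • r) = cross p q + t * cross p r := by
  simp [cross]; ring

theorem cross_linear_left (p q r : Plane) (a b : ℝ) :
    cross (a • p + b • q) r = a * cross p r + b * cross q r := by
  simp [cross]; ring

theorem cross_linear_right (p q r : Plane) (a b : ℝ) :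
    cross r (a • p + b • q) = a * cross r p + b * cross r q := by
  simp [cross]; ring

theorem cross_ray_ne_zero {m : ℕ} {P : Finset Plane} (hP : GeneralPosition m P) {u v : P}
    (huv : u ≠ v) (i : ℤ) : cross ((v : Plane) - u) (ray m i) ≠ 0 := by
  intro h
  have hr : (ray m i) 0 ^ 2 + (ray m i) 1 ^ 2 = 1 := by
    simp [ray, dir]
  set p := (v : Plane) - u with hp
  refine hP.not_parallel u u.2 v v.2 (fun e => huv (Subtype.ext e)) i
    (p 0 * (ray m i) 0 + p 1 * (ray m i) 1) ?_
  rw [← hp]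
  unfold cross at h
  ext j
  fin_cases j
  · change p 0 = (p 0 * (ray m i) 0 + p 1 * (ray m i) 1) * (ray m i) 0
    linear_combination (ray m i 1) * h - p 0 * hr
  · change p 1 = (p 0 * (ray m i) 0 + p 1 * (ray m i) 1) * (ray m i) 1
    linear_combination -(ray m i 0) * h - p 1 * hr

theorem cone_combination {m : ℕ} {i : ℤ} {u v w p : Plane} {a b : ℝ} (hv : v ∈ cone m i u)
    (hw : w ∈ cone m i u) (ha : 0 ≤ a) (hb : 0 ≤ b) (hp : HasCoords u v w p a b) :
    p ∈ cone m i u := by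
  obtain ⟨s, t, hs, ht, rfl⟩ := hv
  obtain ⟨s', t', hs', ht', rfl⟩ := hw
  refine ⟨a * s + b * s', a * t + b * t', by positivity, by positivity, ?_⟩
  rw [hp]; module

/-- Every vertex in a cone lies in one of its subcones. -/
theorem exists_isSubcone_mem {m : ℕ} {P : Finset Plane} (S : SimpleGraph P)
    (hP : GeneralPosition m P) {i : ℤ} {u w : P} (hw : (w : Plane) ∈ cone m i u) :
    ∃ d : Plane, d ∈ cone m i u ∧
      (∀ v : P, S.Adj u v → cross ((v : Plane) - u) (d - u) ≠ 0) ∧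
      ∀ v : P, S.Adj u v →
        0 ≤ cross ((v : Plane) - u) (d - u) * cross ((v : Plane) - u) (w - u) := by
  -- The point d is w pushed slightly along a bounding ray. No constraint at u is parallel to that
  -- ray, so d leaves every constraint line through w and stays on the side of w for all others.
  have ev : ∀ v : P, ∀ᶠ ε in nhdsWithin (0 : ℝ) (Set.Ioi 0), S.Adj u v →
      cross ((v : Plane) - u) (w + ε • ray m i - u) ≠ 0 ∧
      0 ≤ cross ((v : Plane) - u) (w + ε • ray m i - u) * cross ((v : Plane) - u) (w - u) := by
    intro v
    by_cases hv : S.Adj u v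
    swap
    · exact Filter.Eventually.of_forall fun ε h => absurd h hv
    have e : ∀ ε : ℝ, cross ((v : Plane) - u) (w + ε • ray m i - u) =
        cross ((v : Plane) - u) (w - u) + ε * cross ((v : Plane) - u) (ray m i) := by
      intro ε
      rw [← cross_add_smul_right]; congr 1; abel
    have hB := cross_ray_ne_zero hP hv.ne i
    simp only [e]
    generalize cross ((v : Plane) - u) (w - u) = A
    revert hB
    generalize cross ((v : Plane) - u) (ray m i) = B
    intro hB
    by_cases hA : A = 0
    · subst hA
      filter_upwards [self_mem_nhdsWithin] with ε hε _
      exact ⟨by simpa using ⟨(Set.mem_Ioi.1 hε).ne', hB⟩, by simp⟩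
    · have hcont : Filter.Tendsto (fun ε : ℝ => (A + ε * B) * A) (nhds 0)
          (nhds ((A + 0 * B) * A)) := Continuous.tendsto (by fun_prop) 0
      have hpos : 0 < (A + 0 * B) * A := by
        have := mul_self_pos.2 hA
        simpa using this
      filter_upwards [nhdsWithin_le_nhds (hcont.eventually (lt_mem_nhds hpos))] with ε hε _
      exact ⟨fun h => by rw [h] at hε; simp at hε, hε.le⟩
  obtain ⟨ε, hε, hε0⟩ := ((Filter.eventually_all.2 ev).and self_mem_nhdsWithin).exists
  refine ⟨w + ε • ray m i, ?_, fun v hv => (hε v hv).1, fun v hv => (hε v hv).2⟩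
  obtain ⟨s, t, hs, ht, h⟩ := hw
  refine ⟨s + ε, t, add_nonneg hs (le_of_lt hε0), ht, ?_⟩
  rw [h]; module

theorem frameY_ne_zero {m : ℕ} {P : Finset Plane} (hP : GeneralPosition m P) {p q : P}
    (hpq : p ≠ q) (i : ℤ) : frameY m i ((q : Plane) - p) ≠ 0 := by
  rw [← inner_bisector]
  exact hP.not_perpendicular p p.2 q q.2 (fun e => hpq (Subtype.ext e)) i

/-! ### The induction on ℓ¹-distance -/

set_option maxHeartbeats 1000000 in
/-- Visible pairs are joined by walks of length at most `1 / (cos (θ / 2) - sin (θ / 2))` times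
their `ℓ¹`-distance in the frame of the cone. -/
theorem walkWithin_of_canSee {k : ℕ} (hk : 1 ≤ k) {P : Finset Plane} {S : SimpleGraph P}
    (hP : GeneralPosition (4 * k + 4) P) (hS : PlanarConstraints S) (u w : P) (huw : u ≠ w)
    (hsee : CanSee S u w) (i : ℤ) (hi : (w : Plane) ∈ cone (4 * k + 4) i u) :
    WalkWithin (constrainedThetaGraph (4 * k + 4) S) u w
      ((Real.cos (aperture (4 * k + 4) / 2) - Real.sin (aperture (4 * k + 4) / 2))⁻¹ *
        (|frameX (4 * k + 4) i (w - u)| + |frameY (4 * k + 4) i (w - u)|)) := by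
  classical
  have h0 := aperture_half_pos k
  have h1 := aperture_half_lt hk
  have hπ := Real.pi_pos
  have hcs : 0 < Real.cos (aperture (4 * k + 4) / 2) - Real.sin (aperture (4 * k + 4) / 2) := by
    rw [← Real.sin_pi_div_two_sub, sub_pos]
    exact Real.sin_lt_sin_of_lt_of_le_pi_div_two (by linarith) (by linarith) (by linarith)
  have hnorm : ∀ {i : ℤ} {u p : Plane}, p ∈ cone (4 * k + 4) i u → ‖p - u‖ ≤
      (Real.cos (aperture (4 * k + 4) / 2) - Real.sin (aperture (4 * k + 4) / 2))⁻¹ *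
        (frameY (4 * k + 4) i (p - u) - |frameX (4 * k + 4) i (p - u)|) := by
    intro i u p hp
    rw [inv_mul_eq_div, le_div_iff₀ hcs]
    exact norm_mul_le_of_mem_cone hk hp
  have hYX : ∀ {i : ℤ} {u p : P}, u ≠ p → (p : Plane) ∈ cone (4 * k + 4) i u →
      |frameX (4 * k + 4) i (p - u)| < frameY (4 * k + 4) i (p - u) := by
    intro i u p hup hp
    have h1 := norm_mul_le_of_mem_cone hk hp
    have h2 : 0 < ‖(p : Plane) - u‖ :=
      norm_pos_iff.2 (sub_ne_zero.2 fun e => hup (Subtype.ext e.symm))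
    have := mul_pos h2 hcs
    linarith
  set c := (Real.cos (aperture (4 * k + 4) / 2) - Real.sin (aperture (4 * k + 4) / 2))⁻¹
  have hc0 : 0 < c := inv_pos.2 hcs
  clear_value c
  choose idx hidx using fun u p : Plane => exists_mem_cone hk u p
  let N : P × P → ℝ := fun q =>
    |frameX (4 * k + 4) (idx q.1 q.2) (q.2 - q.1)| + |frameY (4 * k + 4) (idx q.1 q.2) (q.2 - q.1)|
  obtain ⟨n, hn⟩ : ∃ n, (Finset.univ.filter fun q : P × P => N q < N (u, w)).card = n := ⟨_, rfl⟩
  induction n using Nat.strong_induction_on generalizing u w i with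
  | _ n ih =>
  set X := frameX (4 * k + 4) i with hX
  set Y := frameY (4 * k + 4) i with hY
  have IH : ∀ p q : P, p ≠ q → CanSee S p q →
      |X ((q : Plane) - p)| + |Y ((q : Plane) - p)| < |X ((w : Plane) - u)| + |Y ((w : Plane) - u)| →
      WalkWithin (constrainedThetaGraph (4 * k + 4) S) p q
        (c * (|X ((q : Plane) - p)| + |Y ((q : Plane) - p)|)) := by
    intro p q hpq hpqs hlt
    -- The link pq is measured here in the frame of uw. Passing to its own cone only decreases its
    -- norm, so both the rank and the bound transfer.
    have hle := frame_l1_le hk _ i _ _ (hidx p q)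
    have hNlt : N (p, q) < N (u, w) :=
      (hle.trans_lt hlt).trans_le (frame_l1_le hk i (idx u w) _ _ hi)
    refine (ih _ ?_ p q hpq hpqs _ (hidx p q) rfl).mono (mul_le_mul_of_nonneg_left hle hc0.le)
    rw [← hn]
    apply Finset.card_lt_card
    refine (Finset.ssubset_iff_of_subset ?_).2 ⟨(p, q), by simpa using hNlt, by simp⟩
    intro x hx
    simp only [Finset.mem_filter, Finset.mem_univ, true_and] at hx ⊢
    exact hx.trans hNlt
  obtain ⟨d, hd, hd1, hd2⟩ := exists_isSubcone_mem S hP hi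
  set C : Set Plane := {p | p ∈ cone (4 * k + 4) i u ∧ ∀ v : P, S.Adj u v →
    (v : Plane) ∈ cone (4 * k + 4) i u →
      0 ≤ cross ((v : Plane) - u) (d - u) * cross ((v : Plane) - u) (p - u)} with hC
  have hsub : IsSubcone (4 * k + 4) S i u C := ⟨d, hd, fun v hv _ => hd1 v hv, rfl⟩
  have hwC : (w : Plane) ∈ C := ⟨hi, fun v hv _ => hd2 v hv⟩
  obtain ⟨v, hv, hmin⟩ := Finset.exists_min_image
    (Finset.univ.filter fun v : P => v ≠ u ∧ CanSee S u v ∧ (v : Plane) ∈ C)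
    (fun v => Y ((v : Plane) - u)) ⟨w, by simpa using ⟨huw.symm, hsee, hwC⟩⟩
  simp only [Finset.mem_filter, Finset.mem_univ, true_and] at hv hmin
  obtain ⟨hvu, hvs, hvC⟩ := hv
  have hadj : (constrainedThetaGraph (4 * k + 4) S).Adj u v := by
    rw [constrainedThetaGraph, SimpleGraph.fromRel_adj]
    refine ⟨hvu.symm, Or.inl ⟨hvu, hvs, i, C, hsub, hvC, ?_⟩⟩
    intro p hp hps hpC
    rw [inner_bisector, inner_bisector]
    exact hmin p ⟨hp, hps, hpC⟩
  have huv := WalkWithin.of_adj hadj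
  rw [dist_comm, dist_eq_norm] at huv
  have hYw := hYX huw hi
  have hYv := hYX hvu.symm hvC.1
  have hnv := hnorm hvC.1
  rw [← hX, ← hY] at hYw hYv hnv
  have hYw0 : 0 < Y ((w : Plane) - u) := (abs_nonneg _).trans_lt hYw
  have hYv0 : 0 < Y ((v : Plane) - u) := (abs_nonneg _).trans_lt hYv
  by_cases hvw : v = w
  · subst hvw
    refine huv.mono (hnv.trans (mul_le_mul_of_nonneg_left ?_ hc0.le))
    rw [abs_of_pos hYw0]
    linarith [abs_nonneg (X ((v : Plane) - u))]
  have hYlt : ∀ p : P, p ≠ v → p ≠ u → CanSee S u p → (p : Plane) ∈ C →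
      Y ((v : Plane) - u) < Y ((p : Plane) - u) := by
    intro p hpv hpu hps hpC
    refine lt_of_le_of_ne (hmin p ⟨hpu, hps, hpC⟩) ?_
    intro h
    refine frameY_ne_zero hP (Ne.symm hpv) i ?_
    have e : (p : Plane) - v = (p - u) - (v - u) := by abel
    rw [e, map_sub, ← hY, ← h, sub_self]
  have hvwY := hYlt w (Ne.symm hvw) huw.symm hsee hwC
  have hcross : ∀ p q : Plane, cross p q = X p * Y q - Y p * X q := cross_eq_frame _ i
  have hdet0 : cross ((w : Plane) - u) (v - u) ≠ 0 := by
    intro h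
    rw [hcross] at h
    rcases eq_or_eq_of_mem_line hP huw (r := v) (Y ((v : Plane) - u) / Y ((w : Plane) - u)) (by
      apply eq_of_frame_eq (m := 4 * k + 4) i
      · rw [map_smul, ← hX, smul_eq_mul]; field_simp; linarith
      · rw [map_smul, ← hY, smul_eq_mul]; field_simp) with h | h
    · exact hvu h
    · exact hvw h
  have hsubC : ∀ {p : Plane} {a b : ℝ}, HasCoords u v w p a b → p - u =
      a • ((v : Plane) - u) + b • ((w : Plane) - u) := by
    intro p a b h; rw [h]; module
  have hfree : FreeSector S u v w := by
    -- A constraint strictly between v and w would separate them strictly, while both are weakly on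
    -- the side of d, which is off its line.
    intro p hp a b ha hb h
    have hpc := cone_combination hvC.1 hi ha.le hb.le h
    have k1 := hvC.2 p hp hpc
    have k2 := hd2 p hp
    have k0 := hd1 p hp
    have e1 : cross ((p : Plane) - u) (v - u) = b * cross ((w : Plane) - u) (v - u) := by
      rw [hsubC h, cross_linear_left]; simp only [hcross]; ring
    have e2 : cross ((p : Plane) - u) (w - u) = -(a * cross ((w : Plane) - u) (v - u)) := by
      rw [hsubC h, cross_linear_left]; simp only [hcross]; ring
    rw [e1] at k1
    rw [e2] at k2
    have k3 : 0 ≤ cross ((p : Plane) - u) (d - u) * cross ((w : Plane) - u) (v - u) :=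
      nonneg_of_mul_nonneg_right (by linarith) hb
    have k4 : 0 ≤ -(cross ((p : Plane) - u) (d - u) * cross ((w : Plane) - u) (v - u)) :=
      nonneg_of_mul_nonneg_right (by linarith) ha
    exact mul_ne_zero k0 hdet0 (by linarith)
  -- The sign reflects the frame, if necessary, so that v lies counterclockwise of w as seen from u.
  obtain ⟨σ, hσ, hdet⟩ : ∃ σ : ℝ, |σ| = 1 ∧ 0 < σ * cross ((w : Plane) - u) (v - u) := by
    rcases hdet0.lt_or_gt with h | h
    · exact ⟨-1, by simp, by linarith⟩
    · exact ⟨1, by simp, by linarith⟩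
  have hσ0 : σ ≠ 0 := by rintro rfl; simp at hσ
  have hXabs : ∀ p, |(σ • X) p| = |X p| := by
    intro p; rw [LinearMap.smul_apply, smul_eq_mul, abs_mul, hσ, one_mul]
  have hdet' : 0 < (σ • X) (w - u) * Y (v - u) - (σ • X) (v - u) * Y (w - u) := by
    rw [hcross] at hdet
    simp only [LinearMap.smul_apply, smul_eq_mul]
    linarith
  have hlow : ∀ (p : P) (a b : ℝ), CanSee S u p → HasCoords u v w p a b → 0 < a → 0 < b →
      a + b < 1 → Y (v - u) < Y (p - u) := by
    intro p a b hps h ha hb hab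
    have hYp : Y ((p : Plane) - u) = a * Y (v - u) + b * Y (w - u) := by
      rw [hsubC h]; simp
    refine hYlt p ?_ ?_ hps ⟨cone_combination hvC.1 hi ha.le hb.le h, ?_⟩
    · rintro rfl
      have : (1 - a) * cross ((w : Plane) - u) (p - u) = 0 := by
        have e : cross ((w : Plane) - u) (p - u) = a * cross ((w : Plane) - u) (p - u) := by
          conv_lhs => rw [hsubC h]
          rw [cross_linear_right]; simp only [hcross]; ring
        linarith
      rcases mul_eq_zero.1 this with h | h
      · linarith
      · exact hdet0 h
    · rintro rfl
      rw [sub_self, map_zero] at hYp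
      nlinarith [mul_pos ha hYv0, mul_pos hb hYw0]
    · intro q hq hqc
      rw [hsubC h, cross_linear_right]
      have k1 := mul_nonneg ha.le (hvC.2 q hq hqc)
      have k2 := mul_nonneg hb.le (hd2 q hq)
      linarith
  have hXw := hXabs (w - u)
  have hXv := hXabs (v - u)
  have hXinj : ∀ p : Plane, (σ • X) p = 0 → Y p = 0 → p = 0 := by
    intro p h1 h2
    refine frame_injective (4 * k + 4) i p ?_ h2
    rw [LinearMap.smul_apply, smul_eq_mul] at h1
    exact (mul_eq_zero.1 h1).resolve_left hσ0
  have IH' : ∀ p q : P, p ≠ q → CanSee S p q →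
      |(σ • X) ((q : Plane) - p)| + |Y ((q : Plane) - p)| <
        |X ((w : Plane) - u)| + |Y ((w : Plane) - u)| →
      WalkWithin (constrainedThetaGraph (4 * k + 4) S) p q
        (c * (|(σ • X) ((q : Plane) - p)| + |Y ((q : Plane) - p)|)) := by
    intro p q
    rw [hXabs]
    exact IH p q
  generalize σ • X = Z at *
  -- The line `Z = M` bounds the triangle on the right: 0 and Z(w) are the abscissas of u and w, and
  -- Z(v) ≤ M by orientation and Y(v) < Y(w). Moreover 2M - Z(w) = |X(w)|, which is what the final
  -- sum needs.
  set M := max 0 (Z (w - u)) with hM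
  have hM0 : 0 ≤ M := le_max_left _ _
  have hMw : Z (w - u) ≤ M := le_max_right _ _
  have hMv : Z (v - u) ≤ M := by nlinarith
  have hMabs : 2 * M - Z (w - u) = |X (w - u)| := by
    rw [← hXw, hM]
    rcases le_total 0 (Z (w - u)) with h | h
    · rw [max_eq_right h, abs_of_nonneg h]; ring
    · rw [max_eq_left h, abs_of_nonpos h]; ring
  have hZv := neg_abs_le (Z (v - u))
  rw [hXv] at hZv
  have hwalk := walkWithin_triangle hP hS u Z Y hXinj hc0.le IH' v w hvs hsee hfree hdet' hvwY hYv0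
    hlow M hMv hMw
    (by
      intro p a b h ha hb hab
      rw [hsubC h, map_add, map_smul, map_smul, smul_eq_mul, smul_eq_mul]
      nlinarith)
    -- The chain is shorter than the ℓ¹-norm of `w - u` by Y(v) + Z(v), which is positive since
    -- |X(v)| < Y(v); hence the induction applies to its links.
    (by rw [abs_of_pos hYw0]; linarith)
  refine (huv.trans hwalk).mono ?_
  rw [abs_of_pos hYw0]
  have : c * (Y (v - u) - |X (v - u)|) ≤ c * (Y (v - u) + Z (v - u)) :=
    mul_le_mul_of_nonneg_left (by linarith) hc0.le
  have e : c * (|X (w - u)| + Y (w - u)) = c * (Y (v - u) + Z (v - u)) +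
      c * (Y (w - u) - Y (v - u) + (2 * M - Z (v - u) - Z (w - u))) := by
    rw [← hMabs]; ring
  linarith

/-! ### The angle α and the final constant -/

/-- The midpoint of the far side of the canonical triangle lies on the bisector. -/
theorem oppositeMidpoint_eq {m : ℕ} (hc : Real.cos (aperture m / 2) ≠ 0) (i : ℤ) (u w : Plane) :
    oppositeMidpoint m i u w = u + frameY m i (w - u) • bisector m i := by
  have hb : ray m i + ray m (i + 1) = (2 * Real.cos (aperture m / 2)) • bisector m i := by
    apply eq_of_frame_eq (m := m) i
    · rw [map_add, map_smul, frameX_ray, frameX_ray_succ, bisector, frameX_dir]; simp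
    · rw [map_add, map_smul, frameY_ray, frameY_ray_succ, bisector, frameY_dir]
      simp; ring
  unfold oppositeMidpoint canonicalCorner
  simp only [inner_bisector, frameY_ray, frameY_ray_succ]
  have e : frameY m i (w - u) • bisector m i =
      (frameY m i (w - u) / Real.cos (aperture m / 2) / 2) •
        ((2 * Real.cos (aperture m / 2)) • bisector m i) := by
    rw [smul_smul]; congr 1; field_simp
  rw [e, ← hb, midpoint_eq_smul_add]
  simp only [invOf_eq_inv]
  module

theorem norm_bisector (m : ℕ) (i : ℤ) : ‖bisector m i‖ = 1 := by
  have := norm_sq_eq_frame m i (bisector m i)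
  rw [bisector, frameX_dir, frameY_dir, Real.sin_sq_add_cos_sq] at this
  exact (pow_eq_one_iff_of_nonneg (norm_nonneg _) two_ne_zero).1 this

end ConstrainedTheta

open ConstrainedTheta in
theorem mainTheorem5 (k : ℕ) (hk : 1 ≤ k) (P : Finset Plane) (S : SimpleGraph P)
    (hP : GeneralPosition (4 * k + 4) P) (hS : PlanarConstraints S)
    (u w : P) (huw : u ≠ w) (hsee : CanSee S u w)
    (i : ℤ) (hi : (w : Plane) ∈ cone (4 * k + 4) i u)
    (θ α : ℝ) (hθ : θ = aperture (4 * k + 4))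
    (hα : α = EuclideanGeometry.angle (w : Plane) (u : Plane)
      (oppositeMidpoint (4 * k + 4) i u w)) :
    ∃ p : (constrainedThetaGraph (4 * k + 4) S).Walk u w, p.IsPath ∧
      walkLength p ≤
        (Real.cos α / Real.cos (θ / 2) +
          (Real.cos α * Real.tan (θ / 2) + Real.sin α) /
            (Real.cos (θ / 2) - Real.sin (θ / 2))) * dist (u : Plane) (w : Plane) := by
  -- The two bounds are equal: over the common denominator the tangent cancels, leaving (cos α + sin
  -- α) / (cos (θ/2) - sin (θ/2)) times |uw|.
  refine ((walkWithin_of_canSee hk hP hS u w huw hsee i hi).mono (le_of_eq ?_)).exists_isPath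
  have h0 := aperture_half_pos k
  have h1 := aperture_half_lt hk
  have hπ := Real.pi_pos
  have hc : 0 < Real.cos (aperture (4 * k + 4) / 2) :=
    Real.cos_pos_of_mem_Ioo ⟨by linarith, by linarith⟩
  have hs := Real.sin_pos_of_pos_of_lt_pi h0 (by linarith)
  have hcs : 0 < Real.cos (aperture (4 * k + 4) / 2) - Real.sin (aperture (4 * k + 4) / 2) := by
    rw [← Real.sin_pi_div_two_sub, sub_pos]
    exact Real.sin_lt_sin_of_lt_of_le_pi_div_two (by linarith) (by linarith) (by linarith)
  have hy : 0 < frameY (4 * k + 4) i ((w : Plane) - u) := by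
    refine lt_of_le_of_ne ?_ (frameY_ne_zero hP huw i).symm
    exact nonneg_of_mul_nonneg_left
      (le_trans (by positivity) ((mem_cone_iff hs hc i (u : Plane) w).1 hi)) hs
  have hα' : α = InnerProductGeometry.angle ((w : Plane) - u) (bisector (4 * k + 4) i) := by
    rw [hα, oppositeMidpoint_eq hc.ne', EuclideanGeometry.angle]
    simp only [vsub_eq_sub, add_sub_cancel_left]
    exact InnerProductGeometry.angle_smul_right_of_pos _ _ hy
  have hcos : Real.cos α * dist (u : Plane) w = frameY (4 * k + 4) i ((w : Plane) - u) := by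
    rw [← inner_bisector, ← InnerProductGeometry.cos_angle_mul_norm_mul_norm, norm_bisector,
      mul_one, hα', dist_comm, dist_eq_norm]
  have hsin : Real.sin α * dist (u : Plane) w = |frameX (4 * k + 4) i ((w : Plane) - u)| := by
    have hnn : 0 ≤ Real.sin α * dist (u : Plane) w :=
      mul_nonneg (hα' ▸ InnerProductGeometry.sin_angle_nonneg _ _) dist_nonneg
    rw [← abs_of_nonneg hnn, ← sq_eq_sq_iff_abs_eq_abs]
    have hn := norm_sq_eq_frame (4 * k + 4) i ((w : Plane) - u)
    rw [← hcos, ← dist_eq_norm, dist_comm] at hn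
    linear_combination hn + dist (u : Plane) w ^ 2 * Real.sin_sq_add_cos_sq α
  rw [hθ, abs_of_pos hy, ← hsin, ← hcos, Real.tan_eq_sin_div_cos]
  have := hc.ne'
  have := hcs.ne'
  field_simp
  ring
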